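/- For $\rho>0$ let $\mathcal A(\rho)$ be the complex Banach space of functions $s(x,y)=\sum_{i,j\ge 0}c_{ij}x^iy^j$ on the bidisk $D_\rho^2=\{(x,y)\in\mathbb C^2:|x|<\rho,\ |y|<\rho\}$ with finite norm $\|s\|_\rho=\sum_{i,j}|c_{ij}|\rho^{i+j}$, and let $\mathcal I(\rho)=\{s\in\mathcal A(\rho):s(0,0)=1\}$. Put $\rho=1.75$, $\rho'=1.0699462890625\,\rho$ and $\delta=0.00405550003051758$. For $s\in\mathcal A(\rho)$ consider pairs $(\lambda,z)$ of a number $\lambda\in\mathbb C$ with $$s(\lambda,1)+s(0,1)=0$$ and an analytic function $z:D_\rho^2\to\mathbb C$ with $z(1,0)=z(0,1)=1$ such that, for all $(x,y)\in D_\rho^2$, the numbers $\lambda x,\lambda y,z(x,y)$ have modulus less than $\rho$ and $$s(\lambda x,z(x,y))+s(\lambda y,z(x,y))=0 .$$ If there is exactly one such pair, write $\lambda=\lambda[s]$, $z=z[s]$, put $\mu=\mu[s]=s(z(0,0),0)$, and, if $\mu\neq 0$ and the following function lies in $\mathcal A(\rho)$, define the EKW renormalization of $s$ by $$\mathcal R[s](x,y)=\mu^{-1}s(z(x,y),\lambda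 y),\qquad (x,y)\in D_\rho^2 ,$$ so that $\mathcal R[s](0,0)=1$. Let $s_0(x,y)=\sum_{i=0}^{6}\left(c_i+b_iy+a_iy^2+d_iy^3\right)x^i$ with $$\begin{array}{c|l|l} i & c_i & b_i\\ \hline 0 & 1 & -2.42962369607899157\cdot10^{-1}\\ 1 & -1.02761956458970711 & 5.87327440047455615\cdot10^{-2}\\ 2 & 2.93663720023727808\cdot10^{-2} & -5.93710236103475834\cdot10^{-3}\\ 3 & -1.87658664952086400\cdot10^{-3} & 6.09332694202817819\cdot10^{-4}\\ 4 & 1.40668294317213841\cdot10^{-4} & -6.46957663100331420\cdot10^{-5}\\ 5 & -1.18664608613747513\cdot10^{-5} & 7.02844653606969302\cdot10^{-6}\\ 6 & 1.06935654680404746\cdot10^{-6} & -7.75814237637266867\cdot10^{-7} \end{array}$$ $$\begin{array}{c|l|l} i & a_i & d_i\\ \hline 0 & -8.77647505670140721\cdot10^{-1} & -1.46791670728014469\cdot10^{-3}\\ 1 & -5.62975994856259201\cdot10^{-3} & 5.62673177268855366\cdot10^{-4}\\ 2 & 9.13999041304226728\cdot10^{-4} & -1.29391532620066284\cdot10^{-4}\\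 3 & -1.33251463600020727\cdot10^{-4} & 2.45371180652649971\cdot10^{-5}\\ 4 & 1.84028385489487478\cdot10^{-5} & -4.18641657324405651\cdot10^{-6}\\ 5 & -2.46417657757601024\cdot10^{-6} & 6.68319468409332288\cdot10^{-7}\\ 6 & 3.23459112039180563\cdot10^{-7} & -1.01939399249366523\cdot10^{-7} \end{array}$$ Then $s_0$ is a polynomial of degree $9$ in $\mathcal I(\rho)$, and with $B_\delta(s_0)$ the open ball of radius $\delta$ about $s_0$ in $\mathcal A(\rho)$ the following hold. (i) $\mathcal R$ is well defined at every $s\in B_\delta(s_0)$ (the pair $(\lambda,z)$ exists and is unique, $\mu[s]\ne0$, and $\mathcal R[s]\in\mathcal A(\rho)$), and $\mathcal R:B_\delta(s_0)\to\mathcal A(\rho)$ is analytic. (ii) For all $s\in B_\delta(s_0)$ with real Taylor coefficients, $\lambda[s]$ and $\mu[s]$ are real and satisfy $$0.000406771898269653\le\mu[s]\le0.120654106140137,\qquad -0.276069164276123\le\lambda[s]\le-0.222213745117188 .$$ (iii) $\mathcal R$ is compact on $B_\delta(s_0)$, that is, it is continuous and maps bounded subsets of $B_\delta(s_0)$ to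 relatively compact subsets of $\mathcal A(\rho)$; moreover $\mathcal R[s]\in\mathcal I(\rho')$ for all $s\in B_\delta(s_0)$. -/

import Mathlib

namespace EKW

/-- Arrays `c i j` of complex Taylor coefficients with `∑ |c i j| ρ ^ (i + j) < ∞`, as a linear
subspace of all arrays. -/
def coeffSubmodule (ρ : ℝ) [hρ : Fact (0 < ρ)] : Submodule ℂ (ℕ → ℕ → ℂ) where
  carrier := {c | Summable fun p : ℕ × ℕ => ‖c p.1 p.2‖ * ρ ^ (p.1 + p.2)}
  zero_mem' := by simp [summable_zero]
  add_mem' := by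
    intro a b ha hb
    have h0 := hρ.out
    refine Summable.of_nonneg_of_le (fun p => by positivity) (fun p => ?_) (ha.add hb)
    rw [← add_mul]
    exact mul_le_mul_of_nonneg_right (norm_add_le _ _) (by positivity)
  smul_mem' := by
    intro k a ha
    have h := ha.mul_left ‖k‖
    simpa [mul_assoc] using h

/-- The space `𝒜(ρ)` of functions `s(x, y) = ∑ c i j x ^ i y ^ j` on the bidisk `|x|, |y| < ρ` with
`∑ |c i j| ρ ^ (i + j) < ∞`. A function is represented by its array of Taylor coefficients at
the origin. -/
def A (ρ : ℝ) [Fact (0 < ρ)] : Type := coeffSubmodule ρ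

section Space

variable {ρ : ℝ} [hρ : Fact (0 < ρ)]

instance : AddCommGroup (A ρ) := inferInstanceAs (AddCommGroup (coeffSubmodule ρ))

instance : Module ℂ (A ρ) := inferInstanceAs (Module ℂ (coeffSubmodule ρ))

/-- The Taylor coefficients of an element of `𝒜(ρ)`. -/
def A.coeff (s : A ρ) : ℕ → ℕ → ℂ := s.1

theorem A.summable (s : A ρ) : Summable fun p : ℕ × ℕ => ‖s.coeff p.1 p.2‖ * ρ ^ (p.1 + p.2) :=
  s.2

/-- The value at `(x, y)`; the series converges absolutely for `|x|, |y| ≤ ρ`. -/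
noncomputable def A.eval (s : A ρ) (x y : ℂ) : ℂ :=
  ∑' p : ℕ × ℕ, s.coeff p.1 p.2 * x ^ p.1 * y ^ p.2

/-- The weighted `ℓ¹` norm. -/
noncomputable instance : Norm (A ρ) :=
  ⟨fun s => ∑' p : ℕ × ℕ, ‖s.coeff p.1 p.2‖ * ρ ^ (p.1 + p.2)⟩

theorem A.norm_def (s : A ρ) : ‖s‖ = ∑' p : ℕ × ℕ, ‖s.coeff p.1 p.2‖ * ρ ^ (p.1 + p.2) := rfl

theorem A.core : NormedSpace.Core ℂ (A ρ) where
  norm_nonneg s := by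
    have h0 := hρ.out
    rw [A.norm_def]
    exact tsum_nonneg fun p => by positivity
  norm_smul k s := by
    rw [A.norm_def, A.norm_def, ← tsum_mul_left]
    refine tsum_congr fun p => ?_
    have h : (k • s).coeff p.1 p.2 = k * s.coeff p.1 p.2 := rfl
    rw [h, norm_mul, mul_assoc]
  norm_triangle s t := by
    have h0 := hρ.out
    rw [A.norm_def, A.norm_def, A.norm_def, ← s.summable.tsum_add t.summable]
    refine (s + t).summable.tsum_le_tsum (fun p => ?_) (s.summable.add t.summable)
    rw [← add_mul]
    have h : (s + t).coeff p.1 p.2 = s.coeff p.1 p.2 + t.coeff p.1 p.2 := rfl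
    rw [h]
    exact mul_le_mul_of_nonneg_right (norm_add_le _ _) (by positivity)
  norm_eq_zero_iff s := by
    have h0 := hρ.out
    constructor
    · intro h
      rw [A.norm_def] at h
      have h1 := (hasSum_zero_iff_of_nonneg (fun p => by positivity)).1 (h ▸ s.summable.hasSum)
      apply Subtype.ext
      funext i j
      have h2 := congrFun h1 (i, j)
      have h3 : ρ ^ (i + j) ≠ 0 := by positivity
      have h4 : ‖s.coeff i j‖ = 0 := by simpa [h3, h0.ne'] using h2
      exact norm_eq_zero.1 h4
    · rintro rfl
      have h : ∀ i j, (0 : A ρ).coeff i j = 0 := fun _ _ => rfl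
      simp [A.norm_def, h]

noncomputable instance : NormedAddCommGroup (A ρ) := NormedAddCommGroup.ofCore A.core

noncomputable instance : NormedSpace ℂ (A ρ) := NormedSpace.ofCore A.core

/-- The set `ℐ(ρ)` of functions in `𝒜(ρ)` with `s(0, 0) = 1`. -/
def I (ρ : ℝ) [Fact (0 < ρ)] : Set (A ρ) := {s | s.eval 0 0 = 1}

/-- The coefficient of `x ^ i y ^ j` in a polynomial in `x = X 0` and `y = X 1`. -/
noncomputable def polyCoeff (P : MvPolynomial (Fin 2) ℂ) (i j : ℕ) : ℂ :=
  P.coeff (Finsupp.single 0 i + Finsupp.single 1 j)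

theorem polyCoeff_mem (P : MvPolynomial (Fin 2) ℂ) : polyCoeff P ∈ coeffSubmodule ρ := by
  refine summable_of_hasFiniteSupport ?_
  have hinj : Function.Injective
      (fun p : ℕ × ℕ => (Finsupp.single 0 p.1 + Finsupp.single 1 p.2 : Fin 2 →₀ ℕ)) := by
    rintro ⟨a, b⟩ ⟨c, d⟩ h
    have h0 := DFunLike.congr_fun h 0
    have h1 := DFunLike.congr_fun h 1
    simp at h0 h1
    rw [h0, h1]
  refine Set.Finite.subset (P.support.finite_toSet.preimage hinj.injOn) ?_
  intro p hp
  have h : polyCoeff P p.1 p.2 ≠ 0 := by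
    intro h
    simp [h] at hp
  simpa [polyCoeff] using h

/-- A polynomial in two variables as an element of `𝒜(ρ)`. -/
noncomputable def A.ofPoly (ρ : ℝ) [Fact (0 < ρ)] (P : MvPolynomial (Fin 2) ℂ) : A ρ :=
  ⟨polyCoeff P, polyCoeff_mem P⟩

/-- The open bidisk of radius `ρ` about the origin. -/
def bidisk (ρ : ℝ) : Set (ℂ × ℂ) := {p | ‖p.1‖ < ρ ∧ ‖p.2‖ < ρ}

/-- `l` is a scaling for `s` and `z` is a midpoint function for `s` with that scaling:
`s(l, 1) + s(0, 1) = 0`, and `z` is analytic on the bidisk and solves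
`s(l x, z(x, y)) + s(l y, z(x, y)) = 0` there with `z(1, 0) = z(0, 1) = 1`; all the arguments at which
`s` has to be evaluated stay in its bidisk. -/
structure IsMidpoint (s : A ρ) (l : ℂ) (z : ℂ × ℂ → ℂ) : Prop where
  scaling_eq : s.eval l 1 + s.eval 0 1 = 0
  analytic : AnalyticOnNhd ℂ z (bidisk ρ)
  arg_mem : ∀ p ∈ bidisk ρ, ‖l * p.1‖ < ρ ∧ ‖l * p.2‖ < ρ ∧ ‖z p‖ < ρ
  midpoint_eq : ∀ p ∈ bidisk ρ, s.eval (l * p.1) (z p) + s.eval (l * p.2) (z p) = 0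
  normalized : z (1, 0) = 1 ∧ z (0, 1) = 1

open Classical in
/-- The scaling `λ[s]` and the midpoint function `z = z[s]` (chosen; they are meaningful where they
exist and are unique, on the bidisk as far as `z` is concerned). -/
noncomputable def solution (s : A ρ) : ℂ × (ℂ × ℂ → ℂ) :=
  if h : ∃ d : ℂ × (ℂ × ℂ → ℂ), IsMidpoint s d.1 d.2 then h.choose else (0, 0)

/-- The scaling `λ[s]`. -/
noncomputable def lam (s : A ρ) : ℂ := (solution s).1

/-- The midpoint function `z[s]`. -/
noncomputable def mid (s : A ρ) : ℂ × ℂ → ℂ := (solution s).2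

/-- The scaling `μ[s] = s(z(0, 0), 0)`, which makes the renormalized function equal to `1` at the
origin. -/
noncomputable def mu (s : A ρ) : ℂ := s.eval (mid s (0, 0)) 0

open Classical in
/-- The renormalization operator: the element of `𝒜(ρ)` given on the bidisk by
`ℛ[s](x, y) = μ⁻¹ s(z(x, y), λ y)`, where there is one. -/
noncomputable def renorm (s : A ρ) : A ρ :=
  if h : ∃ t : A ρ, ∀ p ∈ bidisk ρ, t.eval p.1 p.2 = (mu s)⁻¹ * s.eval (mid s p) (lam s * p.2)
  then h.choose else 0

/-- At `s` the operator is well defined: the scaling and the midpoint function exist and are unique,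
`μ[s] ≠ 0`, and the defining formula gives an element of `𝒜(ρ)`. -/
structure WellDefinedAt (s : A ρ) : Prop where
  isMidpoint : IsMidpoint s (lam s) (mid s)
  unique : ∀ l z, IsMidpoint s l z → l = lam s ∧ Set.EqOn z (mid s) (bidisk ρ)
  mu_ne_zero : mu s ≠ 0
  renorm_eq : ∀ p ∈ bidisk ρ,
    (renorm s).eval p.1 p.2 = (mu s)⁻¹ * s.eval (mid s p) (lam s * p.2)

end Space

/-- A (nonlinear) map is compact on `U` if it is continuous there and maps bounded subsets of `U` to
relatively compact sets. -/
def IsCompactMapOn {E F : Type*} [NormedAddCommGroup E] [NormedAddCommGroup F]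
    (f : E → F) (U : Set E) : Prop :=
  ContinuousOn f U ∧ ∀ B ⊆ U, Bornology.IsBounded B → IsCompact (closure (f '' B))

/-- The radius `ρ = 1.75`. -/
def rho : ℝ := 1.75

/-- The larger radius `ρ' = 1.0699462890625 ρ`. -/
def rho' : ℝ := 1.0699462890625 * rho

instance : Fact (0 < rho) := ⟨by norm_num [rho]⟩

instance : Fact (0 < rho') := ⟨by norm_num [rho', rho]⟩

/-- The radius `δ` of the ball. -/
def delta : ℝ := 0.00405550003051758

/-- The table of coefficients: entry `(j, i)` is the coefficient of `x ^ i y ^ j`. -/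
def table : Fin 4 → Fin 7 → ℚ :=
  ![![1, -1.02761956458970711, 0.0293663720023727808, -0.00187658664952086400,
      0.000140668294317213841, -0.0000118664608613747513, 0.00000106935654680404746],
    ![-0.242962369607899157, 0.0587327440047455615, -0.00593710236103475834,
      0.000609332694202817819, -0.0000646957663100331420, 0.00000702844653606969302,
      -0.000000775814237637266867],
    ![-0.877647505670140721, -0.00562975994856259201, 0.000913999041304226728,
      -0.000133251463600020727, 0.0000184028385489487478, -0.00000246417657757601024,
      0.000000323459112039180563],
    ![-0.00146791670728014469, 0.000562673177268855366, -0.000129391532620066284,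
      0.0000245371180652649971, -0.00000418641657324405651, 0.000000668319468409332288,
      -0.000000101939399249366523]]

/-- The polynomial `s₀`. -/
noncomputable def s0Poly : MvPolynomial (Fin 2) ℂ :=
  ∑ j : Fin 4, ∑ i : Fin 7, MvPolynomial.C (table j i : ℂ) *
    MvPolynomial.X 0 ^ (i : ℕ) * MvPolynomial.X 1 ^ (j : ℕ)

/-- The polynomial `s₀` as an element of `𝒜(1.75)`. -/
noncomputable def s0 : A rho := A.ofPoly rho s0Poly

end EKW

/-! The ball is so small that `s₀` controls everything up to explicit errors. The first equation,
`s(l, 1) + s(0, 1) = 0`, is nearly affine in `l`: `s₀(·, 1)` has slope about `-0.974` and small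
higher coefficients. The midpoint equation is solved pointwise for a number `w`. For `|λx|, |λy| ≤
1/2` each summand `s(λx, w)`, `s(λy, w)` is a perturbation of `-1.888 (w - 0.937)` on the disc of
radius `0.4` about `0.937`. In both cases a Newton iteration with frozen slope is a contraction
(`exists_unique_root`), and the implicit function theorem makes the root analytic in all parameters
(`exists_analytic_root`). Here the parameters are `s` itself and the point `(x, y)`, so `λ[s]` and
`z[s](x, y)` are analytic jointly in `s` and `(x, y)`.

Uniqueness among all admissible pairs needs two more remarks. The condition `|λx| < ρ` on the bidisk
forces `|λ| ≤ 1`, and the equation for `λ` has only one root in the unit disc. An arbitrary midpoint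
function equals `1` at `(1, 0)`, so near that point its values lie in the disc where the root is
unique; the identity theorem does the rest.

Since `|λ| ≤ 0.261`, the construction works for `|x|, |y| < 1.89`, beyond `ρ' < 1.88`. Cauchy's
estimates then bound the Taylor coefficients of `ℛ[s]` by `C / 1.88 ^ (i + j)`, with `C` independent
of `s`. This domination gives membership in `𝒜(ρ)` and `𝒜(ρ')`, analyticity of `ℛ` (a dominated
series of analytic maps is analytic, `analyticOnNhd_tsum`), and compactness, because the coefficient
arrays range in a product of discs. For real `s`, uniqueness makes `λ` and `μ` invariant under
conjugation. -/

namespace EKW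

/-! ### Dominated series of analytic maps between complex Banach spaces. -/

section AnalyticSeries

open Metric
open scoped Nat

variable {E F : Type*} [NormedAddCommGroup E] [NormedSpace ℂ E]
  [NormedAddCommGroup F] [NormedSpace ℂ F]

/-- Cauchy's estimate for the Fréchet derivative. -/
theorem norm_fderiv_le_of_closedBall {f : E → F} {x : E} {ε M : ℝ} (hε : 0 < ε)
    (hf : ∀ y ∈ closedBall x ε, DifferentiableAt ℂ f y) (hM : ∀ y ∈ closedBall x ε, ‖f y‖ ≤ M) :
    ‖fderiv ℂ f x‖ ≤ M / ε := by
  have hM0 : 0 ≤ M := (norm_nonneg _).trans (hM x (mem_closedBall_self hε.le))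
  refine ContinuousLinearMap.opNorm_le_bound _ (by positivity) fun h => ?_
  rcases eq_or_ne h 0 with rfl | hh
  · simp
  have hn : 0 < ‖h‖ := norm_pos_iff.2 hh
  have hmem : ∀ t ∈ closedBall (0 : ℂ) (ε / ‖h‖), x + t • h ∈ closedBall x ε := by
    intro t ht
    rw [mem_closedBall_zero_iff, le_div_iff₀ hn] at ht
    simpa [norm_smul] using ht
  have hline : ∀ t : ℂ, HasDerivAt (fun t : ℂ => x + t • h) h t := fun t => by
    simpa using ((hasDerivAt_id t).smul_const h).const_add x
  have hd : DifferentiableOn ℂ (fun t : ℂ => f (x + t • h)) (closedBall 0 (ε / ‖h‖)) := by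
    intro t ht
    exact ((hf _ (hmem t ht)).comp t (hline t).differentiableAt).differentiableWithinAt
  have hc := Complex.norm_deriv_le_of_forall_mem_sphere_norm_le (div_pos hε hn)
    (DifferentiableOn.diffContOnCl (hd.mono closure_ball_subset_closedBall))
    (fun t ht => hM _ (hmem t (sphere_subset_closedBall ht)))
  have hder : deriv (fun t : ℂ => f (x + t • h)) 0 = fderiv ℂ f x h := by
    have h1 : HasFDerivAt f (fderiv ℂ f x) (x + (0 : ℂ) • h) := by
      simpa using (hf x (mem_closedBall_self hε.le)).hasFDerivAt
    exact (h1.comp_hasDerivAt (0 : ℂ) (hline 0)).deriv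
  rw [hder] at hc
  refine hc.trans (le_of_eq ?_)
  field_simp

/-- Cauchy's estimate is applied once per derivative; each application costs a factor `1 / ε` and a
margin `ε` of the radius. -/
theorem norm_iteratedFDeriv_le_of_ball {f : E → F} {x₀ : E} {R ε M : ℝ} (hε : 0 < ε)
    (hf : AnalyticOnNhd ℂ f (ball x₀ R)) (hM : ∀ y ∈ ball x₀ R, ‖f y‖ ≤ M) (k : ℕ) :
    ∀ x ∈ ball x₀ (R - k * ε), ‖iteratedFDeriv ℂ k f x‖ ≤ M / ε ^ k := by
  induction k with
  | zero => simpa using hM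
  | succ k ih =>
    intro x hx
    have hsub : closedBall x ε ⊆ ball x₀ (R - k * ε) := by
      refine closedBall_subset_ball' ?_
      rw [mem_ball] at hx
      push_cast at hx
      linarith
    have hsub' : ball x₀ (R - k * ε) ⊆ ball x₀ R := ball_subset_ball (by
      have : 0 ≤ k * ε := by positivity
      linarith)
    rw [← norm_fderiv_iteratedFDeriv, pow_succ, ← div_div]
    exact norm_fderiv_le_of_closedBall hε
      (fun y hy => (hf.iteratedFDeriv_of_isOpen isOpen_ball k y
        (hsub' (hsub hy))).differentiableAt) (fun y hy => ih y (hsub hy))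

/-- The margin `R / (k + 1)` leaves room for `k` derivatives, and `(k + 1) ^ k / k!` is at most `e ^
(k + 1)`. The loss is only geometric, so Taylor series keep a positive radius of convergence
depending on `R` alone. -/
theorem norm_taylorTerm_le {f : E → F} {x₀ : E} {R M : ℝ} (hR : 0 < R)
    (hf : AnalyticOnNhd ℂ f (ball x₀ R)) (hM : ∀ y ∈ ball x₀ R, ‖f y‖ ≤ M) (k : ℕ) :
    ‖(k ! : ℂ)⁻¹ • iteratedFDeriv ℂ k f x₀‖ ≤ M * Real.exp 1 * (Real.exp 1 / R) ^ k := by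
  have hM0 : 0 ≤ M := (norm_nonneg _).trans (hM x₀ (mem_ball_self hR))
  have hε : 0 < R / (k + 1) := by positivity
  have h1 := norm_iteratedFDeriv_le_of_ball hε hf hM k x₀ (by
    rw [mem_ball, dist_self, sub_pos, mul_div_assoc', div_lt_iff₀ (by positivity)]
    nlinarith)
  have h2 : ((k : ℝ) + 1) ^ k / k ! ≤ Real.exp 1 * Real.exp 1 ^ k := by
    refine (Real.pow_div_factorial_le_exp _ (by positivity) k).trans (le_of_eq ?_)
    rw [← Real.exp_nat_mul, ← Real.exp_add]
    congr 1
    ring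
  rw [norm_smul, norm_inv, Complex.norm_natCast]
  calc (k ! : ℝ)⁻¹ * ‖iteratedFDeriv ℂ k f x₀‖ ≤ (k ! : ℝ)⁻¹ * (M / (R / (k + 1)) ^ k) := by gcongr
    _ = M * (((k : ℝ) + 1) ^ k / k !) / R ^ k := by
      rw [div_pow]
      field_simp
    _ ≤ M * (Real.exp 1 * Real.exp 1 ^ k) / R ^ k := by gcongr
    _ = _ := by rw [div_pow]; ring

theorem iteratedDeriv_line [CompleteSpace F] {f : E → F} {x₀ : E} (hf : AnalyticAt ℂ f x₀) (y : E)
    (k : ℕ) :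
    iteratedDeriv k (fun t : ℂ => f (x₀ + t • y)) 0 = iteratedFDeriv ℂ k f x₀ fun _ => y := by
  obtain ⟨p, r, hp⟩ := hf
  let u : ℂ →L[ℂ] E := (ContinuousLinearMap.id ℂ ℂ).smulRight y
  have hp0 : HasFPowerSeriesOnBall (fun v => f (x₀ + v)) p (u 0) r := by
    have := hp.comp_sub (-x₀)
    simpa [add_comm] using this
  obtain ⟨r', hq⟩ : HasFPowerSeriesAt ((fun v => f (x₀ + v)) ∘ u)
      (p.compContinuousLinearMap u) 0 := ⟨_, hp0.compContinuousLinearMap⟩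
  have h1 := hq.factorial_smul 1 k
  rw [← iteratedDeriv_eq_iteratedFDeriv] at h1
  have h2 := hp.factorial_smul y k
  rw [← h2]
  rw [show (fun t : ℂ => f (x₀ + t • y)) = (fun v => f (x₀ + v)) ∘ u from rfl, ← h1]
  simp [u, FormalMultilinearSeries.compContinuousLinearMap]

/-- On the complex line through `x₀` in direction `y` this is the one-variable Taylor series,
evaluated at `t = 1`. -/
theorem hasSum_iteratedFDeriv_of_ball [CompleteSpace F] {f : E → F} {x₀ : E} {R : ℝ}
    (hf : AnalyticOnNhd ℂ f (ball x₀ R)) {y : E} (hy : ‖y‖ < R) :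
    HasSum (fun k : ℕ => (k ! : ℂ)⁻¹ • iteratedFDeriv ℂ k f x₀ fun _ => y) (f (x₀ + y)) := by
  have hR : 0 < R := (norm_nonneg y).trans_lt hy
  obtain ⟨r, hr1, hr⟩ : ∃ r : ℝ, 1 < r ∧ r * ‖y‖ < R := by
    obtain ⟨m, h1, h2⟩ := exists_between hy
    have hm : 0 < m := (norm_nonneg y).trans_lt h1
    refine ⟨R / m, (one_lt_div hm).2 h2, ?_⟩
    rw [div_mul_eq_mul_div, div_lt_iff₀ hm]
    exact mul_lt_mul_of_pos_left h1 hR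
  have hd : DifferentiableOn ℂ (fun t : ℂ => f (x₀ + t • y)) (ball 0 r) := by
    intro t ht
    have hmem : x₀ + t • y ∈ ball x₀ R := by
      rw [mem_ball_zero_iff] at ht
      rw [mem_ball_iff_norm, add_sub_cancel_left, norm_smul]
      exact (mul_le_mul_of_nonneg_right ht.le (norm_nonneg _)).trans_lt hr
    have h1 : DifferentiableAt ℂ (fun t : ℂ => x₀ + t • y) t := by fun_prop
    exact ((hf _ hmem).differentiableAt.comp t h1).differentiableWithinAt
  have h := Complex.hasSum_taylorSeries_on_ball hd (z := 1) (by simpa using hr1)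
  simpa [iteratedDeriv_line (hf x₀ (mem_ball_self hR))] using h

/-- A series of analytic maps between complex Banach spaces which is dominated by a summable series
of constants is analytic. -/
theorem analyticOnNhd_tsum [CompleteSpace F] {ι : Type*} {f : ι → E → F} {u : ι → ℝ} {U : Set E}
    (hU : IsOpen U) (hu : Summable u) (hf : ∀ i, AnalyticOnNhd ℂ (f i) U)
    (hfu : ∀ i, ∀ x ∈ U, ‖f i x‖ ≤ u i) :
    AnalyticOnNhd ℂ (fun x => ∑' i, f i x) U := by
  intro x₀ hx₀
  obtain ⟨R, hR, hRU⟩ := Metric.isOpen_iff.1 hU x₀ hx₀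
  have hfa : ∀ i, AnalyticOnNhd ℂ (f i) (ball x₀ R) := fun i => (hf i).mono hRU
  have hfb : ∀ i, ∀ x ∈ ball x₀ R, ‖f i x‖ ≤ u i := fun i x hx => hfu i x (hRU hx)
  have hu0 : ∀ i, 0 ≤ u i := fun i => (norm_nonneg _).trans (hfu i x₀ hx₀)
  set e := Real.exp 1 with he
  have he0 : 0 < e := Real.exp_pos 1
  let p : ι → FormalMultilinearSeries ℂ E F := fun i k => (k ! : ℂ)⁻¹ • iteratedFDeriv ℂ k (f i) x₀
  have hp : ∀ i k, ‖p i k‖ ≤ u i * e * (e / R) ^ k := fun i k =>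
    norm_taylorTerm_le hR (hfa i) (hfb i) k
  have hps : ∀ k, Summable fun i => u i * e * (e / R) ^ k := fun k =>
    (hu.mul_right e).mul_right _
  have hps' : ∀ k, Summable fun i => p i k := fun k =>
    Summable.of_norm_bounded (hps k) (fun i => hp i k)
  -- The expansion of the sum is the termwise sum of the expansions. The bound `(e / R) ^ k` on the
  -- terms of degree `k` makes it converge with radius at least `R / e`.
  let q : FormalMultilinearSeries ℂ E F := fun k => ∑' i, p i k
  have hr0 : 0 < R / e := by positivity
  refine ⟨q, ENNReal.ofReal (R / e), ?_, by simpa using hr0, ?_⟩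
  · rw [ENNReal.ofReal]
    refine q.le_radius_of_bound ((∑' i, u i) * e) fun k => ?_
    rw [Real.coe_toNNReal _ hr0.le]
    have h1 : ‖q k‖ ≤ ∑' i, u i * e * (e / R) ^ k :=
      tsum_of_norm_bounded (hps k).hasSum (fun i => hp i k)
    rw [tsum_mul_right, tsum_mul_right] at h1
    calc _ ≤ (∑' i, u i) * e * (e / R) ^ k * (R / e) ^ k := by gcongr
      _ = (∑' i, u i) * e := by
        rw [mul_assoc, ← mul_pow, show e / R * (R / e) = 1 by field_simp, one_pow, mul_one]
  · intro y hy
    have hy' : ‖y‖ < R / e := by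
      rw [Metric.eball_ofReal, mem_ball_zero_iff] at hy
      exact hy
    have hyR : ‖y‖ < R := hy'.trans_le (div_le_self hR.le (Real.one_le_exp zero_le_one))
    have hb : ∀ i k, ‖p i k fun _ => y‖ ≤ u i * e * (e / R * ‖y‖) ^ k := by
      intro i k
      refine ((p i k).le_opNorm _).trans ?_
      rw [Finset.prod_const, Finset.card_univ, Fintype.card_fin, mul_pow, ← mul_assoc]
      gcongr
      exact hp i k
    have hgeo : Summable fun k : ℕ => (e / R * ‖y‖) ^ k := by
      refine summable_geometric_of_lt_one (by positivity) ?_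
      rw [lt_div_iff₀ he0] at hy'
      rw [div_mul_eq_mul_div, div_lt_one hR]
      linarith
    -- Absolute summability over pairs allows the sums over the index and over the degree to be
    -- interchanged.
    have hsum : Summable fun x : ι × ℕ => p x.1 x.2 fun _ => y :=
      Summable.of_norm_bounded ((hu.mul_right e).mul_of_nonneg hgeo
        (fun i => mul_nonneg (hu0 i) he0.le) (fun k => by positivity)) (fun x => hb x.1 x.2)
    have hcol : ∀ k, q k (fun _ => y) = ∑' i, p i k fun _ => y := fun k =>
      (ContinuousMultilinearMap.apply ℂ (fun _ : Fin k => E) F (fun _ => y)).map_tsum (hps' k)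
    have hrow : ∀ i, HasSum (fun k => p i k fun _ => y) (f i (x₀ + y)) := fun i =>
      hasSum_iteratedFDeriv_of_ball (hfa i) hyR
    have hS := hsum.prod_symm.hasSum
    have h2 := hS.prod_fiberwise (fun k => (hsum.prod_symm.prod_factor k).hasSum)
    have h3 : ∑' x : ℕ × ι, p x.2 x.1 (fun _ => y) = ∑' i, f i (x₀ + y) := by
      have h4 := hsum.hasSum.prod_fiberwise hrow
      rw [h4.tsum_eq]
      exact (Equiv.prodComm ℕ ι).tsum_eq (fun x : ι × ℕ => p x.1 x.2 fun _ => y)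
    simp only [hcol]
    rw [← h3]
    exact h2

end AnalyticSeries

/-! ### The Banach space `𝒜(ρ)` and joint analyticity of evaluation. -/

section Space

open Metric Filter Topology

theorem summable_geometric_pair {a : ℝ} (h0 : 0 ≤ a) (h1 : a < 1) :
    Summable fun p : ℕ × ℕ => a ^ (p.1 + p.2) := by
  simp only [pow_add]
  exact (summable_geometric_of_lt_one h0 h1).mul_of_nonneg (summable_geometric_of_lt_one h0 h1)
    (fun _ => by positivity) (fun _ => by positivity)

/-- Giving up radius from `r` to `q` avoids the factor `n`: the induction closes because `q r ^ n /
(r - q) + r ^ n = r ^ (n + 1) / (r - q)`. Summed against coefficients, this makes `‖s‖ / (ρ - q)` a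
Lipschitz constant for `s`. -/
theorem norm_pow_sub_pow_le {x y : ℂ} {q r : ℝ} (hq : q < r) (hx : ‖x‖ ≤ q) (hy : ‖y‖ ≤ q) (n : ℕ) :
    ‖x ^ n - y ^ n‖ ≤ r ^ n / (r - q) * ‖x - y‖ := by
  have hq0 : 0 ≤ q := (norm_nonneg _).trans hx
  have hrq : 0 < r - q := sub_pos.2 hq
  induction n with
  | zero => simp; positivity
  | succ n ih =>
    have h1 : x ^ (n + 1) - y ^ (n + 1) = x * (x ^ n - y ^ n) + (x - y) * y ^ n := by ring
    have h2 : ‖y ^ n‖ ≤ r ^ n := by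
      rw [norm_pow]
      exact pow_le_pow_left₀ (norm_nonneg _) (hy.trans hq.le) n
    calc ‖x ^ (n + 1) - y ^ (n + 1)‖ ≤ ‖x‖ * ‖x ^ n - y ^ n‖ + ‖x - y‖ * ‖y ^ n‖ := by
          rw [h1, ← norm_mul, ← norm_mul]
          exact norm_add_le _ _
      _ ≤ q * (r ^ n / (r - q) * ‖x - y‖) + ‖x - y‖ * r ^ n := by gcongr
      _ = _ := by
        rw [pow_succ]
        field_simp
        ring

/-- A power series which vanishes near the origin has vanishing coefficients. -/
theorem coeff_eq_zero_of_hasSum_zero {a : ℕ → ℂ}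
    (h : ∀ᶠ x in 𝓝 (0 : ℂ), HasSum (fun n => a n * x ^ n) 0) (n : ℕ) : a n = 0 := by
  have h1 : HasFPowerSeriesAt (fun _ : ℂ => (0 : ℂ)) (FormalMultilinearSeries.ofScalars ℂ a) 0 := by
    rw [hasFPowerSeriesAt_iff]
    filter_upwards [h] with x hx
    simpa [FormalMultilinearSeries.coeff_ofScalars, mul_comm] using hx
  have h2 := h1.eq_zero
  have h3 : (FormalMultilinearSeries.ofScalars ℂ a).coeff n = 0 := by
    rw [h2]
    rfl
  simpa using h3

variable {ρ : ℝ} [hρ : Fact (0 < ρ)]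

theorem A.ext {s t : A ρ} (h : ∀ i j, s.coeff i j = t.coeff i j) : s = t :=
  Subtype.ext (funext fun i => funext fun j => h i j)

theorem A.coeff_sub (s t : A ρ) (i j : ℕ) : (s - t).coeff i j = s.coeff i j - t.coeff i j := rfl

theorem A.norm_coeff_mul_le (s : A ρ) (i j : ℕ) : ‖s.coeff i j‖ * ρ ^ (i + j) ≤ ‖s‖ := by
  have h0 := hρ.out
  rw [A.norm_def]
  exact s.summable.le_tsum (i, j) fun _ _ => by positivity

/-- The coefficient functionals. -/
noncomputable def A.coeffCLM (i j : ℕ) : A ρ →L[ℂ] ℂ :=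
  LinearMap.mkContinuous
    { toFun := fun s => s.coeff i j
      map_add' := fun _ _ => rfl
      map_smul' := fun _ _ => rfl } (ρ ^ (i + j))⁻¹ fun s => by
    have h0 := hρ.out
    rw [inv_mul_eq_div, le_div_iff₀ (by positivity)]
    exact s.norm_coeff_mul_le i j

@[simp] theorem A.coeffCLM_apply (i j : ℕ) (s : A ρ) : A.coeffCLM i j s = s.coeff i j := rfl

/-- The space `𝒜(ρ)` is a weighted `ℓ¹` space. -/
noncomputable def A.equivLp : A ρ ≃ₗᵢ[ℂ] lp (fun _ : ℕ × ℕ => ℂ) 1 where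
  toFun s := ⟨fun p => s.coeff p.1 p.2 * (ρ : ℂ) ^ (p.1 + p.2), by
    have h0 := hρ.out
    refine memℓp_gen ?_
    simpa [abs_of_pos h0] using s.summable⟩
  map_add' s t := by
    ext p
    exact add_mul _ _ _
  map_smul' k s := by
    ext p
    exact mul_assoc _ _ _
  invFun v := ⟨fun i j => v (i, j) / (ρ : ℂ) ^ (i + j), by
    have h0 := hρ.out
    have h := (lp.memℓp v).summable (by norm_num)
    refine h.congr fun p => ?_
    simp [abs_of_pos h0, h0.ne']⟩
  left_inv s := by
    have h0 : (ρ : ℂ) ≠ 0 := Complex.ofReal_ne_zero.2 hρ.out.ne'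
    refine A.ext fun i j => ?_
    exact mul_div_cancel_right₀ _ (pow_ne_zero _ h0)
  right_inv v := by
    have h0 : (ρ : ℂ) ≠ 0 := Complex.ofReal_ne_zero.2 hρ.out.ne'
    ext p
    exact div_mul_cancel₀ _ (pow_ne_zero _ h0)
  norm_map' s := by
    have h0 := hρ.out
    rw [lp.norm_eq_tsum_rpow (by norm_num), A.norm_def]
    simp only [ENNReal.toReal_one, Real.rpow_one, div_one]
    refine tsum_congr fun p => ?_
    change ‖s.coeff p.1 p.2 * (ρ : ℂ) ^ (p.1 + p.2)‖ = _
    simp [abs_of_pos h0]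

instance : CompleteSpace (A ρ) :=
  (A.equivLp (ρ := ρ)).isometry.isUniformInducing.completeSpace_congr
    (A.equivLp (ρ := ρ)).surjective |>.2 inferInstance

/-- The monomial `x ^ i y ^ j`. -/
noncomputable def A.monomial (p : ℕ × ℕ) : A ρ :=
  ⟨fun i j => if (i, j) = p then 1 else 0, by
    refine summable_of_ne_finset_zero (s := {p}) fun b hb => ?_
    have : b ≠ p := by simpa using hb
    simp [this]⟩

theorem A.coeff_monomial (p : ℕ × ℕ) (i j : ℕ) :
    (A.monomial p : A ρ).coeff i j = if (i, j) = p then 1 else 0 := rfl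

theorem A.norm_monomial (p : ℕ × ℕ) : ‖(A.monomial p : A ρ)‖ = ρ ^ (p.1 + p.2) := by
  rw [A.norm_def, tsum_eq_single p]
  · simp [A.coeff_monomial]
  · intro b hb
    simp [A.coeff_monomial, hb]

theorem A.norm_term_le (s : A ρ) {x y : ℂ} (hx : ‖x‖ ≤ ρ) (hy : ‖y‖ ≤ ρ) (p : ℕ × ℕ) :
    ‖s.coeff p.1 p.2 * x ^ p.1 * y ^ p.2‖ ≤ ‖s.coeff p.1 p.2‖ * ρ ^ (p.1 + p.2) := by
  have h0 := hρ.out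
  rw [norm_mul, norm_mul, norm_pow, norm_pow, pow_add, mul_assoc]
  gcongr

theorem A.summable_eval (s : A ρ) {x y : ℂ} (hx : ‖x‖ ≤ ρ) (hy : ‖y‖ ≤ ρ) :
    Summable fun p : ℕ × ℕ => s.coeff p.1 p.2 * x ^ p.1 * y ^ p.2 :=
  Summable.of_norm_bounded s.summable fun p => s.norm_term_le hx hy p

theorem A.norm_eval_le (s : A ρ) {x y : ℂ} (hx : ‖x‖ ≤ ρ) (hy : ‖y‖ ≤ ρ) : ‖s.eval x y‖ ≤ ‖s‖ :=
  tsum_of_norm_bounded s.summable.hasSum fun p => s.norm_term_le hx hy p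

theorem A.eval_sub (s t : A ρ) {x y : ℂ} (hx : ‖x‖ ≤ ρ) (hy : ‖y‖ ≤ ρ) :
    (s - t).eval x y = s.eval x y - t.eval x y := by
  unfold A.eval
  rw [← (s.summable_eval hx hy).tsum_sub (t.summable_eval hx hy)]
  refine tsum_congr fun p => ?_
  rw [A.coeff_sub]
  ring

theorem A.eval_zero_zero (s : A ρ) : s.eval 0 0 = s.coeff 0 0 := by
  unfold A.eval
  rw [tsum_eq_single (0, 0)]
  · simp
  · rintro ⟨i, j⟩ h
    rcases eq_or_ne i 0 with rfl | hi
    · have hj : j ≠ 0 := fun hj => h (by rw [hj])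
      simp [hj]
    · simp [hi]

theorem A.norm_eval_sub_eval_right_le (s : A ρ) {x y y' : ℂ} {q : ℝ} (hq : q < ρ) (hx : ‖x‖ ≤ ρ)
    (hy : ‖y‖ ≤ q) (hy' : ‖y'‖ ≤ q) :
    ‖s.eval x y - s.eval x y'‖ ≤ ‖s‖ / (ρ - q) * ‖y - y'‖ := by
  unfold A.eval
  rw [← (s.summable_eval hx (hy.trans hq.le)).tsum_sub (s.summable_eval hx (hy'.trans hq.le)),
    A.norm_def, ← tsum_div_const, ← tsum_mul_right]
  refine tsum_of_norm_bounded ((s.summable.div_const _).mul_right _).hasSum fun p => ?_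
  have h0 := hρ.out
  rw [← mul_sub, norm_mul, norm_mul, norm_pow, pow_add]
  calc _ ≤ ‖s.coeff p.1 p.2‖ * ρ ^ p.1 * (ρ ^ p.2 / (ρ - q) * ‖y - y'‖) := by
        gcongr
        exact norm_pow_sub_pow_le hq hy hy' _
    _ = _ := by ring

theorem A.norm_eval_sub_eval_left_le (s : A ρ) {x x' y : ℂ} {q : ℝ} (hq : q < ρ) (hy : ‖y‖ ≤ ρ)
    (hx : ‖x‖ ≤ q) (hx' : ‖x'‖ ≤ q) :
    ‖s.eval x y - s.eval x' y‖ ≤ ‖s‖ / (ρ - q) * ‖x - x'‖ := by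
  unfold A.eval
  rw [← (s.summable_eval (hx.trans hq.le) hy).tsum_sub (s.summable_eval (hx'.trans hq.le) hy),
    A.norm_def, ← tsum_div_const, ← tsum_mul_right]
  refine tsum_of_norm_bounded ((s.summable.div_const _).mul_right _).hasSum fun p => ?_
  have h0 := hρ.out
  rw [← sub_mul, ← mul_sub, norm_mul, norm_mul, norm_pow, pow_add]
  calc _ ≤ ‖s.coeff p.1 p.2‖ * (ρ ^ p.1 / (ρ - q) * ‖x - x'‖) * ρ ^ p.2 := by
        gcongr
        exact norm_pow_sub_pow_le hq hx hx' _
    _ = _ := by ring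

/-- The value is jointly analytic in the function and the point. -/
theorem A.analyticAt_eval {s : A ρ} {x y : ℂ} (hx : ‖x‖ < ρ) (hy : ‖y‖ < ρ) :
    AnalyticAt ℂ (fun v : A ρ × ℂ × ℂ => v.1.eval v.2.1 v.2.2) (s, x, y) := by
  have h0 := hρ.out
  obtain ⟨q, hq1, hq⟩ := exists_between (max_lt hx hy)
  have hq0 : 0 < q := (norm_nonneg x).trans_lt ((le_max_left _ _).trans_lt hq1)
  let U : Set (A ρ × ℂ × ℂ) := {v | ‖v.1‖ < ‖s‖ + 1 ∧ ‖v.2.1‖ < q ∧ ‖v.2.2‖ < q}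
  have hU : IsOpen U := by
    have h1 : IsOpen {v : A ρ × ℂ × ℂ | ‖v.1‖ < ‖s‖ + 1} := isOpen_lt (by fun_prop) (by fun_prop)
    have h2 : IsOpen {v : A ρ × ℂ × ℂ | ‖v.2.1‖ < q} := isOpen_lt (by fun_prop) (by fun_prop)
    have h3 : IsOpen {v : A ρ × ℂ × ℂ | ‖v.2.2‖ < q} := isOpen_lt (by fun_prop) (by fun_prop)
    exact h1.inter (h2.inter h3)
  have hu : Summable fun p : ℕ × ℕ => (‖s‖ + 1) * (q / ρ) ^ (p.1 + p.2) :=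
    (summable_geometric_pair (by positivity) ((div_lt_one h0).2 hq)).mul_left _
  refine analyticOnNhd_tsum
    (f := fun (p : ℕ × ℕ) (v : A ρ × ℂ × ℂ) => v.1.coeff p.1 p.2 * v.2.1 ^ p.1 * v.2.2 ^ p.2)
    hU hu (fun p v _ => ?_) (fun p v hv => ?_) (s, x, y)
    ⟨by simp, (le_max_left _ _).trans_lt hq1, (le_max_right _ _).trans_lt hq1⟩
  · have h1 : AnalyticAt ℂ (fun v : A ρ × ℂ × ℂ => v.1.coeff p.1 p.2) v :=
      ((A.coeffCLM p.1 p.2).analyticAt _).comp analyticAt_fst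
    have h2 : AnalyticAt ℂ (fun v : A ρ × ℂ × ℂ => v.2.1) v := analyticAt_fst.comp analyticAt_snd
    have h3 : AnalyticAt ℂ (fun v : A ρ × ℂ × ℂ => v.2.2) v := analyticAt_snd.comp analyticAt_snd
    exact (h1.mul (h2.pow _)).mul (h3.pow _)
  · obtain ⟨hv1, hv2, hv3⟩ := hv
    rw [norm_mul, norm_mul, norm_pow, norm_pow]
    have h1 : ‖v.1.coeff p.1 p.2‖ ≤ (‖s‖ + 1) / ρ ^ (p.1 + p.2) := by
      rw [le_div_iff₀ (by positivity)]
      exact (v.1.norm_coeff_mul_le _ _).trans hv1.le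
    calc _ ≤ (‖s‖ + 1) / ρ ^ (p.1 + p.2) * q ^ p.1 * q ^ p.2 := by gcongr
      _ = _ := by rw [div_pow, pow_add q]; ring

/-- The one-variable identity theorem is used twice: in `x` with `y` fixed, then in `y` for each
coefficient of `x ^ i`. -/
theorem A.eq_of_eval_eq {s t : A ρ} (h : ∀ p ∈ bidisk ρ, s.eval p.1 p.2 = t.eval p.1 p.2) :
    s = t := by
  have h0 := hρ.out
  have hball : ∀ᶠ x in 𝓝 (0 : ℂ), ‖x‖ < ρ := by
    filter_upwards [Metric.ball_mem_nhds (0 : ℂ) h0] with x hx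
    simpa using hx
  have hd : ∀ x y : ℂ, ‖x‖ < ρ → ‖y‖ < ρ → (s - t).eval x y = 0 := fun x y hx hy => by
    rw [A.eval_sub _ _ hx.le hy.le, h (x, y) ⟨hx, hy⟩, sub_self]
  set d := s - t with hdef
  have h1 : ∀ y : ℂ, ‖y‖ < ρ → ∀ i, ∑' j, d.coeff i j * y ^ j = 0 := by
    intro y hy
    refine coeff_eq_zero_of_hasSum_zero ?_
    filter_upwards [hball] with x hx
    have hs := d.summable_eval hx.le hy.le
    have h2 := hs.hasSum.prod_fiberwise fun i => (hs.prod_factor i).hasSum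
    have h3 : ∑' p : ℕ × ℕ, d.coeff p.1 p.2 * x ^ p.1 * y ^ p.2 = 0 := hd x y hx hy
    rw [h3] at h2
    refine h2.congr_fun fun i => ?_
    rw [← tsum_mul_right]
    exact tsum_congr fun j => by ring
  have h2 : ∀ i j, d.coeff i j = 0 := by
    intro i
    refine coeff_eq_zero_of_hasSum_zero ?_
    filter_upwards [hball] with y hy
    rw [← h1 y hy i]
    refine Summable.hasSum ?_
    refine Summable.of_norm_bounded (((d.summable.prod_factor i).div_const (ρ ^ i))) fun j => ?_
    rw [norm_mul, norm_pow, pow_add]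
    field_simp
    gcongr
  refine A.ext fun i j => ?_
  have := h2 i j
  rwa [hdef, A.coeff_sub, sub_eq_zero] at this

end Space

/-! ### Taylor coefficients depending analytically on a parameter. -/

section Taylor

open Metric Filter Topology
open scoped Nat

variable {P : Type*} [NormedAddCommGroup P] [NormedSpace ℂ P]

/-- The coefficient of `x ^ n` in the expansion of `G (p, x)` at `x = 0`. -/
noncomputable def taylorCoeff (G : P × ℂ → ℂ) (n : ℕ) (p : P) : ℂ :=
  (n ! : ℂ)⁻¹ * iteratedDeriv n (fun x => G (p, x)) 0

variable {U : Set P} {G : P × ℂ → ℂ} {r M : ℝ}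

/-- The partial derivative in `x` is the full iterated derivative of `G` at `(p, 0)` in the
direction `(0, 1)`, and that derivative is analytic in its base point. -/
theorem analyticOnNhd_taylorCoeff (hU : IsOpen U) (hr : 0 < r)
    (hG : AnalyticOnNhd ℂ G (U ×ˢ ball 0 r)) (n : ℕ) : AnalyticOnNhd ℂ (taylorCoeff G n) U := by
  intro p hp
  have h1 : AnalyticAt ℂ (fun p => iteratedFDeriv ℂ n G (p, (0 : ℂ)) fun _ => (0, 1)) p := by
    have h2 := hG.iteratedFDeriv_of_isOpen (hU.prod isOpen_ball) n (p, 0)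
      ⟨hp, mem_ball_self hr⟩
    have h3 : AnalyticAt ℂ (fun p : P => (p, (0 : ℂ))) p := analyticAt_id.prod analyticAt_const
    exact ((ContinuousMultilinearMap.apply ℂ (fun _ : Fin n => P × ℂ) ℂ
      (fun _ => (0, 1))).analyticAt _).comp (h2.comp_of_eq h3 rfl)
  refine ((analyticAt_const (v := (n ! : ℂ)⁻¹)).mul h1).congr ?_
  filter_upwards [hU.mem_nhds hp] with p' hp'
  simp [taylorCoeff, ← iteratedDeriv_line (hG (p', 0) ⟨hp', mem_ball_self hr⟩) (0, 1) n]

theorem differentiableOn_slice (hG : AnalyticOnNhd ℂ G (U ×ˢ ball 0 r)) {p : P} (hp : p ∈ U) :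
    DifferentiableOn ℂ (fun x => G (p, x)) (ball 0 r) := fun x hx =>
  ((hG (p, x) ⟨hp, hx⟩).differentiableAt.comp x
    ((differentiableAt_const p).prodMk differentiableAt_id)).differentiableWithinAt

theorem norm_taylorCoeff_le (hG : AnalyticOnNhd ℂ G (U ×ˢ ball 0 r))
    (hM : ∀ q ∈ U ×ˢ ball 0 r, ‖G q‖ ≤ M) {r' : ℝ} (hr' : 0 < r') (hr : r' < r) {p : P}
    (hp : p ∈ U) (n : ℕ) : ‖taylorCoeff G n p‖ ≤ M / r' ^ n := by
  have hsub : closedBall (0 : ℂ) r' ⊆ ball 0 r := closedBall_subset_ball hr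
  have h := Complex.norm_iteratedDeriv_le_of_forall_mem_sphere_norm_le n hr'
    (((differentiableOn_slice hG hp).mono
      (closure_ball_subset_closedBall.trans hsub)).diffContOnCl)
    (fun z hz => hM (p, z) ⟨hp, hsub (sphere_subset_closedBall hz)⟩)
  rw [taylorCoeff, norm_mul, norm_inv, Complex.norm_natCast]
  refine (mul_le_mul_of_nonneg_left h (by positivity)).trans (le_of_eq ?_)
  field_simp

theorem hasSum_taylorCoeff (hG : AnalyticOnNhd ℂ G (U ×ˢ ball 0 r)) {p : P} (hp : p ∈ U) {x : ℂ}
    (hx : x ∈ ball 0 r) : HasSum (fun n => taylorCoeff G n p * x ^ n) (G (p, x)) := by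
  refine (Complex.hasSum_taylorSeries_on_ball (differentiableOn_slice hG hp) hx).congr_fun
    fun n => ?_
  rw [taylorCoeff, sub_zero, smul_eq_mul, smul_eq_mul]
  ring

/-- Expansion in two variables of a bounded analytic function, with analytic dependence on a
parameter. -/
theorem exists_analytic_coeff (hU : IsOpen U) {G : P × ℂ × ℂ → ℂ} {r' : ℝ} (hr' : 0 < r')
    (hr : r' < r) (hG : AnalyticOnNhd ℂ G (U ×ˢ ball 0 r ×ˢ ball 0 r))
    (hM : ∀ q ∈ U ×ˢ ball 0 r ×ˢ ball 0 r, ‖G q‖ ≤ M) :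
    ∃ c : ℕ × ℕ → P → ℂ, (∀ n, AnalyticOnNhd ℂ (c n) U) ∧
      (∀ n, ∀ p ∈ U, ‖c n p‖ ≤ M / r' ^ (n.1 + n.2)) ∧
      ∀ p ∈ U, ∀ x ∈ ball 0 r', ∀ y ∈ ball 0 r',
        HasSum (fun n => c n p * x ^ n.1 * y ^ n.2) (G (p, x, y)) := by
  obtain ⟨t, ht1, ht⟩ := exists_between hr
  have h0 : 0 < r := hr'.trans hr
  have ht0 : 0 < t := hr'.trans ht1
  -- Reordering makes `y` part of the parameter, so that `x` can be expanded first and `y`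
  -- afterwards by the same lemmas.
  let H : (P × ℂ) × ℂ → ℂ := fun q => G (q.1.1, q.2, q.1.2)
  have hH : AnalyticOnNhd ℂ H ((U ×ˢ ball 0 r) ×ˢ ball 0 r) := by
    intro q hq
    have h1 : AnalyticAt ℂ (fun q : (P × ℂ) × ℂ => (q.1.1, q.2, q.1.2)) q :=
      (analyticAt_fst.comp analyticAt_fst).prod
        (analyticAt_snd.prod (analyticAt_snd.comp analyticAt_fst))
    exact (hG (q.1.1, q.2, q.1.2) ⟨hq.1.1, hq.2, hq.1.2⟩).comp_of_eq h1 rfl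
  have hHM : ∀ q ∈ (U ×ˢ ball 0 r) ×ˢ ball 0 r, ‖H q‖ ≤ M := fun q hq =>
    hM (q.1.1, q.2, q.1.2) ⟨hq.1.1, hq.2, hq.1.2⟩
  have ha : ∀ i, AnalyticOnNhd ℂ (taylorCoeff H i) (U ×ˢ ball 0 r) := fun i =>
    analyticOnNhd_taylorCoeff (hU.prod isOpen_ball) h0 hH i
  have hb : ∀ i, ∀ q ∈ U ×ˢ ball 0 r, ‖taylorCoeff H i q‖ ≤ M / t ^ i := fun i q hq =>
    norm_taylorCoeff_le hH hHM ht0 ht hq i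
  have hM0 : ∀ p ∈ U, 0 ≤ M := fun p hp =>
    (norm_nonneg _).trans (hM (p, 0, 0) ⟨hp, mem_ball_self h0, mem_ball_self h0⟩)
  refine ⟨fun n => taylorCoeff (taylorCoeff H n.1) n.2, fun n =>
    analyticOnNhd_taylorCoeff hU h0 (ha n.1) n.2, fun n p hp => ?_, fun p hp x hx y hy => ?_⟩
  · refine (norm_taylorCoeff_le (ha n.1) (hb n.1) hr' hr hp n.2).trans ?_
    rw [div_div, pow_add]
    have := hM0 p hp
    gcongr
  · have hM1 := hM0 p hp
    have hx' : x ∈ ball 0 r := ball_subset_ball hr.le hx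
    have hy' : y ∈ ball 0 r := ball_subset_ball hr.le hy
    have h1 := hasSum_taylorCoeff hH (p := (p, y)) ⟨hp, hy'⟩ hx'
    rw [mem_ball_zero_iff] at hx hy
    have hs : Summable fun n : ℕ × ℕ =>
        taylorCoeff (taylorCoeff H n.1) n.2 p * x ^ n.1 * y ^ n.2 := by
      have hx1 : Summable fun n => (‖x‖ / r') ^ n :=
        summable_geometric_of_lt_one (by positivity) ((div_lt_one hr').2 hx)
      have hy1 : Summable fun n => (‖y‖ / r') ^ n :=
        summable_geometric_of_lt_one (by positivity) ((div_lt_one hr').2 hy)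
      refine Summable.of_norm_bounded ((hx1.mul_of_nonneg hy1 (fun _ => by positivity)
        (fun _ => by positivity)).mul_left M) fun n => ?_
      rw [norm_mul, norm_mul, norm_pow, norm_pow]
      calc _ ≤ M / t ^ n.1 / r' ^ n.2 * ‖x‖ ^ n.1 * ‖y‖ ^ n.2 := by
            gcongr
            exact norm_taylorCoeff_le (ha n.1) (hb n.1) hr' hr hp n.2
        _ ≤ M / r' ^ n.1 / r' ^ n.2 * ‖x‖ ^ n.1 * ‖y‖ ^ n.2 := by gcongr
        _ = _ := by rw [div_pow, div_pow]; ring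
    have h2 := hs.hasSum.prod_fiberwise fun i =>
      (((hasSum_taylorCoeff (ha i) hp hy').mul_left (x ^ i)).congr_fun fun j => by ring :
        HasSum (fun j => taylorCoeff (taylorCoeff H i) j p * x ^ i * y ^ j) _)
    have h3 := h1.unique (h2.congr_fun fun i => mul_comm _ _)
    exact (show G (p, x, y) = _ from h3) ▸ hs.hasSum

end Taylor

/-! ### Elements of `𝒜(ρ)` with prescribed coefficients of geometric decay. -/

section Series

open Metric Filter Topology

variable {ρ : ℝ} [hρ : Fact (0 < ρ)]

/-- The element of `𝒜(ρ)` with given coefficients. -/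
noncomputable def A.ofCoeff (ρ : ℝ) [Fact (0 < ρ)] (c : ℕ × ℕ → ℂ) : A ρ :=
  ∑' n, c n • A.monomial n

variable {M r : ℝ}

theorem summable_norm_bound (hr : ρ < r) :
    Summable fun n : ℕ × ℕ => M / r ^ (n.1 + n.2) * ρ ^ (n.1 + n.2) := by
  have h0 := hρ.out
  have hr0 := h0.trans hr
  refine ((summable_geometric_pair (by positivity) ((div_lt_one hr0).2 hr)).mul_left M).congr
    fun n => ?_
  rw [div_pow]
  ring

theorem A.norm_smul_monomial_le {c : ℕ × ℕ → ℂ} {n : ℕ × ℕ} (hc : ‖c n‖ ≤ M / r ^ (n.1 + n.2)) :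
    ‖c n • (A.monomial n : A ρ)‖ ≤ M / r ^ (n.1 + n.2) * ρ ^ (n.1 + n.2) := by
  have h0 := hρ.out
  rw [norm_smul, A.norm_monomial]
  gcongr

theorem A.coeff_ofCoeff {c : ℕ × ℕ → ℂ} (hr : ρ < r) (hc : ∀ n, ‖c n‖ ≤ M / r ^ (n.1 + n.2))
    (i j : ℕ) : (A.ofCoeff ρ c).coeff i j = c (i, j) := by
  have hs : Summable fun n => c n • (A.monomial n : A ρ) :=
    Summable.of_norm_bounded (summable_norm_bound (M := M) hr)
      fun n => A.norm_smul_monomial_le (hc n)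
  have h := (A.coeffCLM (ρ := ρ) i j).map_tsum hs
  rw [A.coeffCLM_apply] at h
  rw [A.ofCoeff, h, tsum_eq_single (i, j)]
  · rw [map_smul, A.coeffCLM_apply, A.coeff_monomial]
    simp
  · intro n hn
    rw [map_smul, A.coeffCLM_apply, A.coeff_monomial, if_neg hn.symm, smul_zero]

/-- The elements of `𝒜(ρ)` with coefficients `O(r ^ -(i + j))`, `r > ρ`, form a compact set. -/
theorem A.isCompact_ofCoeff_image (hr : ρ < r) :
    IsCompact (A.ofCoeff ρ '' {c | ∀ n, ‖c n‖ ≤ M / r ^ (n.1 + n.2)}) := by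
  have hK : {c : ℕ × ℕ → ℂ | ∀ n, ‖c n‖ ≤ M / r ^ (n.1 + n.2)} =
      Set.univ.pi fun n => closedBall 0 (M / r ^ (n.1 + n.2)) := by
    ext c
    simp
  -- A product of closed discs is compact by Tychonoff, and the sum map is continuous for
  -- coefficientwise convergence because the series is uniformly dominated, `r` being larger than
  -- `ρ`.
  refine IsCompact.image_of_continuousOn ?_ ?_
  · rw [hK]
    exact isCompact_univ_pi fun n => isCompact_closedBall _ _
  · exact continuousOn_tsum (fun n => by fun_prop) (summable_norm_bound (M := M) hr)
      fun n c hc => A.norm_smul_monomial_le (hc n)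

theorem analyticOnNhd_ofCoeff {P : Type*} [NormedAddCommGroup P] [NormedSpace ℂ P] {U : Set P}
    (hU : IsOpen U) {c : ℕ × ℕ → P → ℂ} (hr : ρ < r) (hc : ∀ n, AnalyticOnNhd ℂ (c n) U)
    (hM : ∀ n, ∀ p ∈ U, ‖c n p‖ ≤ M / r ^ (n.1 + n.2)) :
    AnalyticOnNhd ℂ (fun p => A.ofCoeff ρ fun n => c n p) U := by
  refine analyticOnNhd_tsum hU (summable_norm_bound (M := M) hr)
    (fun n p hp => (hc n p hp).smul analyticAt_const)
    (fun n p hp => A.norm_smul_monomial_le (c := fun n => c n p) (hM n p hp))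

end Series

/-! ### Roots of nearly affine functions and their analytic dependence on parameters. -/

section Root

open Metric Filter Topology
open scoped ContDiff

variable {P : Type*} [NormedAddCommGroup P] [NormedSpace ℂ P] [CompleteSpace P]

/-- A function of `w` in a disc which is close to `D * (w - w₀)` has exactly one zero there. -/
theorem exists_unique_root {f : ℂ → ℂ} {w₀ D : ℂ} {R κ : ℝ} (hκ : κ < 1) (hκ0 : 0 ≤ κ) (hD : D ≠ 0)
    (hR : 0 < R)
    (hlip : ∀ w ∈ closedBall w₀ R, ∀ w' ∈ closedBall w₀ R,
      ‖f w - f w' - D * (w - w')‖ ≤ κ * ‖D‖ * ‖w - w'‖)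
    (hmap : ∀ w ∈ closedBall w₀ R, ‖f w - D * (w - w₀)‖ < ‖D‖ * R) :
    ∃ z ∈ ball w₀ R, f z = 0 ∧ ∀ w ∈ closedBall w₀ R, f w = 0 → w = z := by
  have hDn : 0 < ‖D‖ := norm_pos_iff.2 hD
  -- The Newton map with frozen slope `D`: its fixed points are the zeros of `f`, and the two
  -- hypotheses say that it is a `κ`-contraction and maps the closed disc into the open one.
  let T : ℂ → ℂ := fun w => w - f w / D
  have hTball : ∀ w ∈ closedBall w₀ R, T w ∈ ball w₀ R := by
    intro w hw
    have h1 : T w - w₀ = -((f w - D * (w - w₀)) / D) := by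
      simp only [T]
      field_simp
      ring
    rw [mem_ball_iff_norm, h1, norm_neg, norm_div, div_lt_iff₀ hDn, mul_comm R]
    exact hmap w hw
  have hT : Set.MapsTo T (closedBall w₀ R) (closedBall w₀ R) := fun w hw =>
    ball_subset_closedBall (hTball w hw)
  have hTlip : ∀ w ∈ closedBall w₀ R, ∀ w' ∈ closedBall w₀ R, ‖T w - T w'‖ ≤ κ * ‖w - w'‖ := by
    intro w hw w' hw'
    have h1 : T w - T w' = -((f w - f w' - D * (w - w')) / D) := by
      simp only [T]
      field_simp
      ring
    rw [h1, norm_neg, norm_div, div_le_iff₀ hDn]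
    calc _ ≤ _ := hlip w hw w' hw'
      _ = _ := by ring
  have hC : ContractingWith (⟨κ, hκ0⟩ : NNReal) (hT.restrict T _ _) := by
    refine ⟨hκ, LipschitzWith.of_dist_le_mul fun w w' => ?_⟩
    rw [Subtype.dist_eq, Subtype.dist_eq, dist_eq_norm, dist_eq_norm]
    exact hTlip w w.2 w' w'.2
  obtain ⟨z, hz, hfix, -⟩ := hC.exists_fixedPoint' isClosed_closedBall.isComplete hT
    (mem_closedBall_self hR.le) (edist_ne_top _ _)
  have hz0 : f z = 0 := by
    have h1 : z - f z / D = z := hfix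
    have h2 : f z / D = 0 := by simpa using h1
    simpa [hD] using h2
  refine ⟨z, ?_, hz0, fun w hw hw0 => ?_⟩
  · have h1 := hTball z hz
    rwa [show T z = z from hfix] at h1
  · have h1 := hTlip w hw z hz
    simp only [T, hw0, hz0, zero_div, sub_zero] at h1
    have h2 : ‖w - z‖ = 0 := by nlinarith [norm_nonneg (w - z)]
    exact sub_eq_zero.1 (norm_eq_zero.1 h2)

/-- Analytic dependence on a parameter of the zero in a disc of a function close to
`D * (w - w₀)`. -/
theorem exists_analytic_root {U : Set P} (hU : IsOpen U) {F : P × ℂ → ℂ} {w₀ D : ℂ} {R κ : ℝ}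
    (hκ : κ < 1) (hκ0 : 0 ≤ κ) (hD : D ≠ 0) (hR : 0 < R)
    (hF : ∀ p ∈ U, ∀ w ∈ closedBall w₀ R, AnalyticAt ℂ F (p, w))
    (hlip : ∀ p ∈ U, ∀ w ∈ closedBall w₀ R, ∀ w' ∈ closedBall w₀ R,
      ‖F (p, w) - F (p, w') - D * (w - w')‖ ≤ κ * ‖D‖ * ‖w - w'‖)
    (hmap : ∀ p ∈ U, ∀ w ∈ closedBall w₀ R, ‖F (p, w) - D * (w - w₀)‖ < ‖D‖ * R) :
    ∃ z : P → ℂ, AnalyticOnNhd ℂ z U ∧ ∀ p ∈ U, z p ∈ ball w₀ R ∧ F (p, z p) = 0 ∧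
      ∀ w ∈ closedBall w₀ R, F (p, w) = 0 → w = z p := by
  have hex : ∀ p, ∃ z, p ∈ U → z ∈ ball w₀ R ∧ F (p, z) = 0 ∧
      ∀ w ∈ closedBall w₀ R, F (p, w) = 0 → w = z := by
    intro p
    by_cases hp : p ∈ U
    · obtain ⟨z, h1, h2, h3⟩ := exists_unique_root hκ hκ0 hD hR (hlip p hp) (hmap p hp)
      exact ⟨z, fun _ => ⟨h1, h2, h3⟩⟩
    · exact ⟨0, fun h => absurd h hp⟩
  choose z hz using hex
  refine ⟨z, fun p hp => ?_, hz⟩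
  obtain ⟨hzb, hz0, -⟩ := hz p hp
  have hFa : ContDiffAt ℂ ω F (p, z p) := (hF p hp _ (ball_subset_closedBall hzb)).contDiffAt
  -- If the derivative in `w` vanished, `F (p, t) - D * t` would have derivative `-D`, of modulus
  -- larger than its Lipschitz constant `κ * ‖D‖`.
  have hder : fderiv ℂ F (p, z p) (0, 1) ≠ 0 := by
    intro h0
    have hline : HasDerivAt (fun t : ℂ => ((p, t) : P × ℂ)) (0, 1) (z p) :=
      (hasDerivAt_const _ _).prodMk (hasDerivAt_id _)
    have h1 : HasDerivAt (fun t : ℂ => F (p, t)) 0 (z p) := by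
      rw [← h0]
      exact ((hFa.differentiableAt (by simp)).hasFDerivAt).comp_hasDerivAt (z p) hline
    have h2 : HasDerivAt (fun t : ℂ => F (p, t) - D * t) (0 - D * 1) (z p) :=
      h1.sub ((hasDerivAt_id _).const_mul D)
    have h3 := h2.le_of_lip' (C := κ * ‖D‖) (by positivity) (by
      filter_upwards [isOpen_ball.mem_nhds hzb] with w hw
      have := hlip p hp w (ball_subset_closedBall hw) _ (ball_subset_closedBall hzb)
      rwa [mul_sub, sub_sub_sub_comm] at this)
    rw [zero_sub, mul_one, norm_neg] at h3
    nlinarith [norm_pos_iff.2 hD]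
  have hinv : (fderiv ℂ F (p, z p) ∘L .inr ℂ P ℂ).IsInvertible := by
    refine ⟨ContinuousLinearEquiv.unitsEquivAut ℂ (Units.mk0 _ hder), ?_⟩
    ext
    simp
  have hψ := hFa.contDiffAt_implicitFunction (by simp) hinv
  have hψ0 := hFa.implicitFunction_apply_self (by simp) hinv
  have hψF := hFa.eventually_apply_implicitFunction (by simp) hinv
  set ψ := hFa.implicitFunction (by simp) hinv
  have hψa : AnalyticAt ℂ ψ p := hψ.analyticAt
  refine hψa.congr ?_
  -- The implicit function stays in the disc near `p`, where the root is unique, hence it coincides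
  -- with `z` there.
  have hb : ∀ᶠ p' in 𝓝 p, ψ p' ∈ ball w₀ R :=
    hψa.continuousAt.eventually_mem (isOpen_ball.mem_nhds (by rw [hψ0]; exact hzb))
  filter_upwards [hb, hψF, hU.mem_nhds hp] with p' h1 h2 h3
  exact (hz p' h3).2.2 _ (ball_subset_closedBall h1) (h2.trans hz0)

end Root

/-! ### The polynomial `s₀`: evaluation, degree and normalization. -/

section Polynomial

variable {ρ : ℝ} [hρ : Fact (0 < ρ)]

theorem hasSum_polyCoeff (P : MvPolynomial (Fin 2) ℂ) (x y : ℂ) :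
    HasSum (fun p : ℕ × ℕ => polyCoeff P p.1 p.2 * x ^ p.1 * y ^ p.2)
      (MvPolynomial.eval ![x, y] P) := by
  induction P using MvPolynomial.induction_on' with
  | monomial u a =>
    have h : MvPolynomial.eval ![x, y] (MvPolynomial.monomial u a) =
        polyCoeff (MvPolynomial.monomial u a) (u 0, u 1).1 (u 0, u 1).2 *
          x ^ (u 0, u 1).1 * y ^ (u 0, u 1).2 := by
      have hu : Finsupp.single 0 (u 0) + Finsupp.single 1 (u 1) = u := by
        ext i
        fin_cases i <;> simp
      simp [MvPolynomial.eval_monomial, polyCoeff, hu, Finsupp.prod_fintype, mul_assoc]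
    rw [h]
    refine hasSum_single _ fun p hp => ?_
    have hne : u ≠ Finsupp.single 0 p.1 + Finsupp.single 1 p.2 := by
      rintro rfl
      simp at hp
    simp [polyCoeff, MvPolynomial.coeff_monomial, hne]
  | add p q hp hq =>
    rw [map_add]
    refine (hp.add hq).congr_fun fun n => ?_
    simp only [polyCoeff, MvPolynomial.coeff_add]
    ring

theorem A.eval_ofPoly (P : MvPolynomial (Fin 2) ℂ) (x y : ℂ) :
    (A.ofPoly ρ P).eval x y = MvPolynomial.eval ![x, y] P :=
  (hasSum_polyCoeff P x y).tsum_eq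

/-- The coefficient of `y ^ j` in `s₀`, as a function of `x`. -/
noncomputable def row (j : Fin 4) (x : ℂ) : ℂ := ∑ i : Fin 7, (table j i : ℂ) * x ^ (i : ℕ)

theorem s0_eval (x y : ℂ) :
    s0.eval x y = row 0 x + row 1 x * y + row 2 x * (y * y) + row 3 x * (y * y * y) := by
  rw [s0, A.eval_ofPoly, s0Poly, map_sum]
  simp only [map_sum, map_mul, map_pow, MvPolynomial.eval_C, MvPolynomial.eval_X,
    Matrix.cons_val_zero, Matrix.cons_val_one, ← Finset.sum_mul]
  rw [Fin.sum_univ_four]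
  simp only [row, Fin.val_zero, Fin.val_one, Fin.val_two, show ((3 : Fin 4) : ℕ) = 3 from rfl]
  ring

theorem s0Poly_totalDegree : s0Poly.totalDegree = 9 := by
  have hterm : ∀ (j : Fin 4) (i : Fin 7), MvPolynomial.C (table j i : ℂ) *
      MvPolynomial.X 0 ^ (i : ℕ) * MvPolynomial.X 1 ^ (j : ℕ) =
      MvPolynomial.monomial (Finsupp.single (0 : Fin 2) (i : ℕ) + Finsupp.single 1 (j : ℕ))
        (table j i : ℂ) := by
    intro j i
    rw [MvPolynomial.X_pow_eq_monomial, MvPolynomial.X_pow_eq_monomial, MvPolynomial.C_mul_monomial,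
      MvPolynomial.monomial_mul, mul_one, mul_one]
  have hdeg : ∀ a b : ℕ, ((Finsupp.single (0 : Fin 2) a + Finsupp.single 1 b).sum fun _ e => e)
      = a + b := by
    intro a b
    rw [Finsupp.sum_fintype _ _ (fun _ => rfl)]
    simp
  refine le_antisymm ?_ ?_
  · refine MvPolynomial.totalDegree_finsetSum_le fun j _ =>
      MvPolynomial.totalDegree_finsetSum_le fun i _ => ?_
    rw [hterm]
    refine (MvPolynomial.totalDegree_monomial_le _ _).trans ?_
    refine (hdeg i j).trans_le ?_
    omega
  · rw [show 9 = 6 + 3 from rfl, ← hdeg 6 3]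
    refine MvPolynomial.le_totalDegree (MvPolynomial.mem_support_iff.2 ?_)
    have hc : s0Poly.coeff (Finsupp.single (0 : Fin 2) 6 + Finsupp.single 1 3) = (table 3 6 : ℂ) := by
      rw [s0Poly, MvPolynomial.coeff_sum, Finset.sum_eq_single (3 : Fin 4),
        MvPolynomial.coeff_sum, Finset.sum_eq_single (6 : Fin 7)]
      · rw [hterm, MvPolynomial.coeff_monomial]
        exact if_pos rfl
      · intro i _ hi
        rw [hterm, MvPolynomial.coeff_monomial, if_neg]
        intro h
        have := DFunLike.congr_fun h 0
        simp at this
        exact hi (Fin.ext this)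
      · simp
      · intro j _ hj
        rw [MvPolynomial.coeff_sum]
        refine Finset.sum_eq_zero fun i _ => ?_
        rw [hterm, MvPolynomial.coeff_monomial, if_neg]
        intro h
        have := DFunLike.congr_fun h 1
        simp at this
        exact hj (Fin.ext this)
      · simp
    rw [hc]
    simp [table]
    norm_num

theorem s0_mem_I : s0 ∈ I rho := by
  change s0.eval 0 0 = 1
  rw [s0_eval]
  simp [row, Fin.sum_univ_succ, table]

end Polynomial

/-! ### Explicit estimates on `s₀` and on its perturbations in the ball. -/

section Numerics

open Metric

theorem norm_pow_sub_pow_le_of_le_one {x y : ℂ} (hx : ‖x‖ ≤ 1) (hy : ‖y‖ ≤ 1) (n : ℕ) :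
    ‖x ^ n - y ^ n‖ ≤ n * ‖x - y‖ := by
  induction n with
  | zero => simp
  | succ n ih =>
    have h1 : x ^ (n + 1) - y ^ (n + 1) = x * (x ^ n - y ^ n) + (x - y) * y ^ n := by ring
    have h2 : ‖y ^ n‖ ≤ 1 := by
      rw [norm_pow]
      exact pow_le_one₀ (norm_nonneg _) hy
    rw [h1]
    refine (norm_add_le_of_le (norm_mul_le_of_le hx ih) (norm_mul_le_of_le le_rfl h2)).trans ?_
    push_cast
    linarith

/-- A tail of a row is bounded by the sum of the moduli of its terms. -/
theorem norm_tail_le {n : ℕ} (a : Fin n → ℚ) {x : ℂ} {q : ℝ} (hx : ‖x‖ ≤ q) (e : Fin n → ℕ) :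
    ‖∑ i, (a i : ℂ) * x ^ e i‖ ≤ ∑ i, |(a i : ℝ)| * q ^ e i := by
  refine norm_sum_le_of_le _ fun i _ => ?_
  rw [norm_mul, norm_pow, Complex.norm_ratCast]
  gcongr

theorem norm_row_le (j : Fin 4) {x : ℂ} {q : ℝ} (hx : ‖x‖ ≤ q) :
    ‖row j x‖ ≤ ∑ i : Fin 7, |(table j i : ℝ)| * q ^ (i : ℕ) :=
  norm_tail_le (table j) hx _

theorem norm_row_sub_le (j : Fin 4) {x : ℂ} {q : ℝ} (hx : ‖x‖ ≤ q) :
    ‖row j x - table j 0‖ ≤ ∑ i : Fin 6, |(table j i.succ : ℝ)| * q ^ (i.succ : ℕ) := by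
  refine le_of_eq_of_le ?_ (norm_tail_le (fun i : Fin 6 => table j i.succ) hx fun i => i.succ)
  congr 1
  rw [row, Fin.sum_univ_succ]
  simp

theorem norm_row_sub_sub_le (j : Fin 4) {x : ℂ} {q : ℝ} (hx : ‖x‖ ≤ q) :
    ‖row j x - table j 0 - table j 1 * x‖ ≤
      ∑ i : Fin 5, |(table j i.succ.succ : ℝ)| * q ^ (i.succ.succ : ℕ) := by
  refine le_of_eq_of_le ?_
    (norm_tail_le (fun i : Fin 5 => table j i.succ.succ) hx fun i => i.succ.succ)
  congr 1
  rw [row, Fin.sum_univ_succ, Fin.sum_univ_succ]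
  simp

variable {x : ℂ}

/-- In the applications `x` stands for `λx` or `λy`; the bound `1 / 2` covers `0.261 * 1.89`, the
largest modulus that occurs. -/
theorem norm_row_zero_sub_sub_le (hx : ‖x‖ ≤ 1 / 2) :
    ‖row 0 x - 1 - table 0 1 * x‖ ≤ 0.0076 := by
  have h := norm_row_sub_sub_le 0 hx
  rw [show table 0 0 = 1 from rfl, Rat.cast_one] at h
  refine h.trans ?_
  simp [Fin.sum_univ_succ, table]
  norm_num [abs_of_pos, abs_of_neg]

theorem norm_row_one_sub_le (hx : ‖x‖ ≤ 1 / 2) : ‖row 1 x - table 1 0‖ ≤ 0.031 := by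
  refine (norm_row_sub_le 1 hx).trans ?_
  simp [Fin.sum_univ_succ, table]
  norm_num [abs_of_pos, abs_of_neg]

theorem norm_row_two_sub_le (hx : ‖x‖ ≤ 1 / 2) : ‖row 2 x - table 2 0‖ ≤ 0.0031 := by
  refine (norm_row_sub_le 2 hx).trans ?_
  simp [Fin.sum_univ_succ, table]
  norm_num [abs_of_pos, abs_of_neg]

theorem norm_row_three_le (hx : ‖x‖ ≤ 1 / 2) : ‖row 3 x‖ ≤ 0.0018 := by
  refine (norm_row_le 3 hx).trans ?_
  simp [Fin.sum_univ_succ, table]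
  norm_num [abs_of_pos, abs_of_neg]

/-- The approximate scaling. -/
noncomputable def lam₀ : ℝ := -0.249

/-- The approximate value of the midpoint function at the origin. -/
noncomputable def mid₀ : ℝ := 0.937

variable {s : A rho}

theorem norm_pert_le (hs : s ∈ ball s0 delta) {x y : ℂ} (hx : ‖x‖ ≤ rho) (hy : ‖y‖ ≤ rho) :
    ‖s.eval x y - s0.eval x y‖ ≤ 0.0041 := by
  rw [← A.eval_sub _ _ hx hy]
  refine ((s - s0).norm_eval_le hx hy).trans ?_
  rw [mem_ball_iff_norm] at hs
  exact hs.le.trans (by norm_num [delta])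

theorem norm_pert_sub_left_le (hs : s ∈ ball s0 delta) {x x' y : ℂ} (hx : ‖x‖ ≤ 1) (hx' : ‖x'‖ ≤ 1)
    (hy : ‖y‖ ≤ rho) :
    ‖(s.eval x y - s0.eval x y) - (s.eval x' y - s0.eval x' y)‖ ≤ 0.0055 * ‖x - x'‖ := by
  have h1 : (1 : ℝ) ≤ rho := by norm_num [rho]
  rw [← A.eval_sub _ _ (hx.trans h1) hy, ← A.eval_sub _ _ (hx'.trans h1) hy]
  refine ((s - s0).norm_eval_sub_eval_left_le (by norm_num [rho]) hy hx hx').trans ?_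
  rw [mem_ball_iff_norm] at hs
  gcongr
  rw [div_le_iff₀ (by norm_num [rho])]
  exact hs.le.trans (by norm_num [delta, rho])

/-- The radius `1.337 = 0.937 + 0.4` encloses the disc in which the midpoint is sought, and `0.01`
exceeds `δ / (ρ - 1.337)`. -/
theorem norm_pert_sub_right_le (hs : s ∈ ball s0 delta) {x y y' : ℂ} (hx : ‖x‖ ≤ rho)
    (hy : ‖y‖ ≤ 1.337) (hy' : ‖y'‖ ≤ 1.337) :
    ‖(s.eval x y - s0.eval x y) - (s.eval x y' - s0.eval x y')‖ ≤ 0.01 * ‖y - y'‖ := by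
  have h1 : (1.337 : ℝ) ≤ rho := by norm_num [rho]
  rw [← A.eval_sub _ _ hx (hy.trans h1), ← A.eval_sub _ _ hx (hy'.trans h1)]
  refine ((s - s0).norm_eval_sub_eval_right_le (by norm_num [rho]) hx hy hy').trans ?_
  rw [mem_ball_iff_norm] at hs
  gcongr
  rw [div_le_iff₀ (by norm_num [rho])]
  exact hs.le.trans (by norm_num [delta, rho])

/-- The coefficients of `s₀(x, 1)`. -/
theorem s0_eval_one (x : ℂ) :
    s0.eval x 1 = ∑ i : Fin 7, ((table 0 i + table 1 i + table 2 i + table 3 i : ℚ) : ℂ) *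
      x ^ (i : ℕ) := by
  rw [s0_eval]
  simp only [row, mul_one, ← Finset.sum_add_distrib]
  refine Finset.sum_congr rfl fun i _ => ?_
  push_cast
  ring

/-- The slope `-0.974` approximates the linear coefficient of `s₀(x, 1)`. The estimate is made on
the whole unit disc, not only near `lam₀`, because the uniqueness of `λ` needs it there. -/
theorem scaling_lipschitz (hs : s ∈ ball s0 delta) {l l' : ℂ} (hl : ‖l‖ ≤ 1) (hl' : ‖l'‖ ≤ 1) :
    ‖(s.eval l 1 + s.eval 0 1) - (s.eval l' 1 + s.eval 0 1) - (-0.974 : ℂ) * (l - l')‖ ≤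
      0.062 * ‖(-0.974 : ℂ)‖ * ‖l - l'‖ := by
  have hD : ‖(-0.974 : ℂ)‖ = 0.974 := by rw [norm_neg]; norm_num
  have h1 : (1 : ℝ) ≤ rho := by norm_num [rho]
  have hp := norm_pert_sub_left_le hs hl hl' (y := 1) (by simpa using h1)
  have hq : ‖s0.eval l 1 - s0.eval l' 1 - (-0.974 : ℂ) * (l - l')‖ ≤ 0.0531 * ‖l - l'‖ := by
    -- The coefficients of `s₀(x, 1) + 0.974 x`; the sum of `i |a i|` is a Lipschitz constant on the
    -- unit disc.
    let a : Fin 7 → ℚ := fun i => table 0 i + table 1 i + table 2 i + table 3 i +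
      if i = 1 then 0.974 else 0
    have h2 : s0.eval l 1 - s0.eval l' 1 - (-0.974 : ℂ) * (l - l') =
        ∑ i, (a i : ℂ) * (l ^ (i : ℕ) - l' ^ (i : ℕ)) := by
      rw [s0_eval_one, s0_eval_one, Fin.sum_univ_seven, Fin.sum_univ_seven, Fin.sum_univ_seven]
      simp [a]
      norm_num
      ring
    have h3 : ∑ i, |(a i : ℝ)| * (i : ℕ) ≤ 0.0531 := by
      simp [Fin.sum_univ_succ, a, table]
      norm_num [abs_of_pos, abs_of_neg]
    rw [h2]
    have h4 : ∀ i ∈ Finset.univ, ‖(a i : ℂ) * (l ^ (i : ℕ) - l' ^ (i : ℕ))‖ ≤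
        |(a i : ℝ)| * (i : ℕ) * ‖l - l'‖ := by
      intro i _
      rw [norm_mul, Complex.norm_ratCast, mul_assoc]
      gcongr
      exact norm_pow_sub_pow_le_of_le_one hl hl' _
    refine (norm_sum_le_of_le _ h4).trans ?_
    rw [← Finset.sum_mul]
    gcongr
  have h4 : (s.eval l 1 + s.eval 0 1) - (s.eval l' 1 + s.eval 0 1) - (-0.974 : ℂ) * (l - l') =
      (s0.eval l 1 - s0.eval l' 1 - (-0.974 : ℂ) * (l - l')) +
      ((s.eval l 1 - s0.eval l 1) - (s.eval l' 1 - s0.eval l' 1)) := by ring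
  rw [h4, hD]
  refine (norm_add_le_of_le hq hp).trans ?_
  nlinarith [norm_nonneg (l - l')]

theorem norm_le_of_mem_closedBall_lam {l : ℂ} (hl : l ∈ closedBall (lam₀ : ℂ) 0.012) :
    ‖l‖ ≤ 0.261 := by
  rw [mem_closedBall_iff_norm] at hl
  have h := norm_add_le_of_le hl (le_refl ‖(lam₀ : ℂ)‖)
  rw [sub_add_cancel, Complex.norm_real] at h
  refine h.trans ?_
  norm_num [lam₀, abs_of_neg]

theorem scaling_close (hs : s ∈ ball s0 delta) {l : ℂ} (hl : l ∈ closedBall (lam₀ : ℂ) 0.012) :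
    ‖(s.eval l 1 + s.eval 0 1) - (-0.974 : ℂ) * (l - lam₀)‖ < ‖(-0.974 : ℂ)‖ * 0.012 := by
  have hD : ‖(-0.974 : ℂ)‖ = 0.974 := by rw [norm_neg]; norm_num
  have h1 : (1 : ℝ) ≤ rho := by norm_num [rho]
  have hl1 := (norm_le_of_mem_closedBall_lam hl).trans (show (0.261 : ℝ) ≤ 1 by norm_num)
  have hl0 : ‖(lam₀ : ℂ)‖ ≤ 1 := by rw [Complex.norm_real]; norm_num [lam₀, abs_of_neg]
  have hlip := scaling_lipschitz hs hl1 hl0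
  have hp := norm_pert_le hs (hl0.trans h1) (y := 1) (by simpa using h1)
  have hp0 := norm_pert_le hs (x := 0) (y := 1) (by simpa using zero_le_one.trans h1) (by simpa using h1)
  have hv : ‖s0.eval (lam₀ : ℂ) 1 + s0.eval 0 1‖ ≤ 0.0002 := by
    have h2 : s0.eval (lam₀ : ℂ) 1 + s0.eval 0 1 = ((∑ i : Fin 7, ((table 0 i + table 1 i +
        table 2 i + table 3 i : ℚ) : ℝ) * lam₀ ^ (i : ℕ) +
        ((table 0 0 + table 1 0 + table 2 0 + table 3 0 : ℚ) : ℝ) : ℝ) : ℂ) := by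
      rw [s0_eval_one, s0_eval_one]
      simp [Fin.sum_univ_succ]
    rw [h2, Complex.norm_real, Real.norm_eq_abs, abs_le]
    simp [Fin.sum_univ_succ, table, lam₀]
    norm_num
  rw [mem_closedBall_iff_norm] at hl
  have h4 : (s.eval l 1 + s.eval 0 1) - (-0.974 : ℂ) * (l - lam₀) =
      ((s.eval l 1 + s.eval 0 1) - (s.eval lam₀ 1 + s.eval 0 1) - (-0.974 : ℂ) * (l - lam₀)) +
      (s.eval lam₀ 1 - s0.eval lam₀ 1) + (s.eval 0 1 - s0.eval 0 1) +
      (s0.eval lam₀ 1 + s0.eval 0 1) := by ring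
  rw [h4, hD]
  rw [hD] at hlip
  refine (norm_add_le_of_le (norm_add_le_of_le (norm_add_le_of_le hlip hp) hp0) hv).trans_lt ?_
  nlinarith

theorem norm_le_of_mem_closedBall_mid {w : ℂ} (hw : w ∈ closedBall (mid₀ : ℂ) 0.4) :
    ‖w‖ ≤ 1.337 := by
  rw [mem_closedBall_iff_norm] at hw
  have h := norm_add_le_of_le hw (le_refl ‖(mid₀ : ℂ)‖)
  rw [sub_add_cancel, Complex.norm_real] at h
  refine h.trans ?_
  norm_num [mid₀]

theorem norm_mid_slope : ‖(-1.888 : ℂ)‖ = 1.888 := by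
  rw [norm_neg]
  norm_num

theorem norm_table_zero_one : ‖(table 0 1 : ℂ)‖ ≤ 1.0277 := by
  rw [Complex.norm_ratCast]
  simp [table]
  norm_num [abs_of_pos, abs_of_neg]

theorem norm_table_two_zero : ‖(table 2 0 : ℂ)‖ ≤ 0.8777 := by
  rw [Complex.norm_ratCast]
  simp [table]
  norm_num [abs_of_pos, abs_of_neg]

theorem norm_slope_sub_le :
    ‖(table 1 0 : ℂ) + table 2 0 * (2 * mid₀) - (-1.888)‖ ≤ 0.0004 := by
  have h : (table 1 0 : ℂ) + table 2 0 * (2 * mid₀) - (-1.888) =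
      ((table 1 0 + table 2 0 * (2 * 0.937) + 1.888 : ℚ) : ℂ) := by
    rw [mid₀]
    push_cast
    ring
  rw [h, Complex.norm_ratCast]
  simp [table]
  norm_num [abs_of_pos, abs_of_neg]

theorem midpoint_lipschitz (hs : s ∈ ball s0 delta) (hx : ‖x‖ ≤ 1 / 2) {w w' : ℂ}
    (hw : w ∈ closedBall (mid₀ : ℂ) 0.4) (hw' : w' ∈ closedBall (mid₀ : ℂ) 0.4) :
    ‖s.eval x w - s.eval x w' - (-1.888 : ℂ) * (w - w')‖ ≤
      0.41 * ‖(-1.888 : ℂ)‖ * ‖w - w'‖ := by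
  have h1 := norm_le_of_mem_closedBall_mid hw
  have h2 := norm_le_of_mem_closedBall_mid hw'
  have hp := norm_pert_sub_right_le hs (hx.trans (by norm_num [rho])) h1 h2
  have e1 := norm_row_one_sub_le hx
  have e2 := norm_mul_le_of_le (norm_row_two_sub_le hx) (norm_add_le_of_le h1 h2)
  rw [mem_closedBall_iff_norm] at hw hw'
  have e3 := norm_mul_le_of_le norm_table_two_zero (norm_add_le_of_le hw hw')
  have e4 := norm_mul_le_of_le (norm_row_three_le hx) (norm_add_le_of_le (norm_add_le_of_le
    (norm_mul_le_of_le h1 h1) (norm_mul_le_of_le h1 h2)) (norm_mul_le_of_le h2 h2))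
  have e := norm_add_le_of_le (norm_add_le_of_le (norm_add_le_of_le (norm_add_le_of_le e1 e2) e3)
    norm_slope_sub_le) e4
  -- The divided difference of the cubic in `w` is compared with the slope of `1 + b₀ w + a₀ w²` at
  -- `mid₀`, which is nearly `-1.888`. The main error, about `0.70` out of the permitted `0.41 *
  -- 1.888`, comes from the curvature `a₀` over the disc of radius `0.4`.
  have hid : s.eval x w - s.eval x w' - (-1.888 : ℂ) * (w - w') =
      (row 1 x - table 1 0 + (row 2 x - table 2 0) * (w + w') +
        table 2 0 * ((w - mid₀) + (w' - mid₀)) + (table 1 0 + table 2 0 * (2 * mid₀) - (-1.888)) +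
        row 3 x * (w * w + w * w' + w' * w')) * (w - w') +
      ((s.eval x w - s0.eval x w) - (s.eval x w' - s0.eval x w')) := by
    rw [s0_eval, s0_eval]
    ring
  rw [hid, norm_mid_slope]
  refine (norm_add_le_of_le (norm_mul_le_of_le e le_rfl) hp).trans ?_
  rw [← add_mul]
  gcongr
  norm_num

theorem norm_s0_eval_zero_mid_le :
    ‖1 + (table 1 0 : ℂ) * mid₀ + table 2 0 * (mid₀ * mid₀)‖ ≤ 0.0018 := by
  have h : 1 + (table 1 0 : ℂ) * mid₀ + table 2 0 * (mid₀ * mid₀) =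
      ((1 + table 1 0 * 0.937 + table 2 0 * (0.937 * 0.937) : ℚ) : ℂ) := by
    rw [mid₀]
    push_cast
    ring
  rw [h, Complex.norm_ratCast]
  simp [table]
  norm_num [abs_of_pos, abs_of_neg]

theorem midpoint_close (hs : s ∈ ball s0 delta) (hx : ‖x‖ ≤ 1 / 2) {w : ℂ}
    (hw : w ∈ closedBall (mid₀ : ℂ) 0.4) :
    ‖s.eval x w - (-1.888 : ℂ) * (w - mid₀)‖ < ‖(-1.888 : ℂ)‖ * 0.4 := by
  have h1 := norm_le_of_mem_closedBall_mid hw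
  have hp := norm_pert_le hs (hx.trans (by norm_num [rho]))
    (h1.trans (show (1.337 : ℝ) ≤ rho by norm_num [rho]))
  rw [mem_closedBall_iff_norm] at hw
  have e1 := norm_mul_le_of_le norm_slope_sub_le hw
  have e2 := norm_mul_le_of_le norm_table_two_zero (norm_mul_le_of_le hw hw)
  have e3 := norm_mul_le_of_le norm_table_zero_one hx
  have e4 := norm_row_zero_sub_sub_le hx
  have e5 := norm_mul_le_of_le (norm_row_one_sub_le hx) h1
  have e6 := norm_mul_le_of_le (norm_row_two_sub_le hx) (norm_mul_le_of_le h1 h1)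
  have e7 := norm_mul_le_of_le (norm_row_three_le hx)
    (norm_mul_le_of_le (norm_mul_le_of_le h1 h1) h1)
  have e := norm_add_le_of_le (norm_add_le_of_le (norm_add_le_of_le (norm_add_le_of_le
    (norm_add_le_of_le (norm_add_le_of_le (norm_add_le_of_le (norm_add_le_of_le
    norm_s0_eval_zero_mid_le e1) e2) e3) e4) e5) e6) e7) hp
  -- Expansion about `(0, mid₀)`. The largest contributions are the linear term in `x` (about
  -- `0.51`) and the quadratic term in `w - mid₀` (about `0.14`), against `1.888 * 0.4`.
  have hid : s.eval x w - (-1.888 : ℂ) * (w - mid₀) =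
      1 + table 1 0 * mid₀ + table 2 0 * (mid₀ * mid₀) +
      (table 1 0 + table 2 0 * (2 * mid₀) - (-1.888)) * (w - mid₀) +
      table 2 0 * ((w - mid₀) * (w - mid₀)) + table 0 1 * x + (row 0 x - 1 - table 0 1 * x) +
      (row 1 x - table 1 0) * w + (row 2 x - table 2 0) * (w * w) + row 3 x * (w * w * w) +
      (s.eval x w - s0.eval x w) := by
    rw [s0_eval]
    ring
  rw [hid, norm_mid_slope]
  refine e.trans_lt ?_
  norm_num

/-- The value at the origin of the midpoint function is close to `mid₀`. -/
theorem norm_sub_mid_le (hs : s ∈ ball s0 delta) {w : ℂ} (hw : w ∈ closedBall (mid₀ : ℂ) 0.4)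
    (h0 : s.eval 0 w = 0) : ‖w - mid₀‖ ≤ 0.0065 := by
  have hm : (mid₀ : ℂ) ∈ closedBall (mid₀ : ℂ) 0.4 := mem_closedBall_self (by norm_num)
  have hx : ‖(0 : ℂ)‖ ≤ 1 / 2 := by norm_num
  have h1 := midpoint_lipschitz hs hx hw hm
  have hr : (0 : ℝ) ≤ rho := by norm_num [rho]
  have hp := norm_pert_le hs (x := 0) (y := (mid₀ : ℂ)) (by simpa using hr)
    ((norm_le_of_mem_closedBall_mid hm).trans (by norm_num [rho]))
  have hv : ‖s0.eval 0 (mid₀ : ℂ)‖ ≤ 0.001 := by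
    have h : s0.eval 0 (mid₀ : ℂ) = ((table 0 0 + table 1 0 * 0.937 + table 2 0 * (0.937 * 0.937) +
        table 3 0 * (0.937 * 0.937 * 0.937) : ℚ) : ℂ) := by
      rw [s0_eval, mid₀]
      simp [row, Fin.sum_univ_succ]
    rw [h, Complex.norm_ratCast]
    simp [table]
    norm_num [abs_of_pos, abs_of_neg]
  -- Since `w` is a root, the distance to `mid₀` is at most the residual at `mid₀`, `0.0041 +
  -- 0.001`, divided by `(1 - 0.41) * 1.888`.
  have h2 : (-1.888 : ℂ) * (w - mid₀) =
      -(s.eval 0 w - s.eval 0 mid₀ - (-1.888 : ℂ) * (w - mid₀)) +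
      -(s.eval 0 mid₀ - s0.eval 0 mid₀) + -s0.eval 0 mid₀ := by
    rw [h0]
    ring
  have h3 := norm_add_le_of_le (norm_add_le_of_le ((norm_neg _).trans_le h1)
    ((norm_neg _).trans_le hp)) ((norm_neg _).trans_le hv)
  rw [← h2, norm_mul, norm_mid_slope] at h3
  nlinarith

theorem norm_eval_mid_sub_le (hs : s ∈ ball s0 delta) {w : ℂ} (hw : ‖w - mid₀‖ ≤ 0.0065) :
    ‖s.eval w 0 - (0.061 : ℝ)‖ ≤ 0.02 := by
  have hm : ‖(mid₀ : ℂ)‖ = 0.937 := by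
    rw [Complex.norm_real]
    norm_num [mid₀]
  have hw1 : ‖w‖ ≤ 1 := by
    have h := norm_add_le_of_le hw hm.le
    rw [sub_add_cancel] at h
    exact h.trans (by norm_num)
  have hr : (0 : ℝ) ≤ rho := by norm_num [rho]
  have hp := norm_pert_le hs (y := 0) (hw1.trans (by norm_num [rho])) (by simpa using hr)
  -- Here `1.1` is a Lipschitz constant of `s₀(·, 0)` on the unit disc.
  have h1 : ‖row 0 w - row 0 mid₀‖ ≤ 1.1 * 0.0065 := by
    have h2 : row 0 w - row 0 mid₀ = ∑ i : Fin 7, (table 0 i : ℂ) *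
        (w ^ (i : ℕ) - (mid₀ : ℂ) ^ (i : ℕ)) := by
      simp only [row, mul_sub, Finset.sum_sub_distrib]
    have h3 : ∀ i ∈ Finset.univ, ‖(table 0 i : ℂ) * (w ^ (i : ℕ) - (mid₀ : ℂ) ^ (i : ℕ))‖ ≤
        |(table 0 i : ℝ)| * (i : ℕ) * 0.0065 := by
      intro i _
      rw [norm_mul, Complex.norm_ratCast, mul_assoc]
      gcongr
      refine (norm_pow_sub_pow_le_of_le_one hw1 (hm.trans_le (by norm_num)) _).trans ?_
      gcongr
    rw [h2]
    refine (norm_sum_le_of_le _ h3).trans ?_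
    rw [← Finset.sum_mul]
    gcongr
    simp [Fin.sum_univ_succ, table]
    norm_num [abs_of_pos, abs_of_neg]
  have h2 : ‖row 0 (mid₀ : ℂ) - (0.061 : ℝ)‖ ≤ 0.001 := by
    have h : row 0 (mid₀ : ℂ) - (0.061 : ℝ) =
        ((∑ i : Fin 7, table 0 i * (0.937) ^ (i : ℕ) - 0.061 : ℚ) : ℂ) := by
      rw [row, mid₀]
      push_cast
      ring
    rw [h, Complex.norm_ratCast]
    simp [Fin.sum_univ_succ, table]
    norm_num [abs_of_pos, abs_of_neg]
  have h3 : s.eval w 0 - (0.061 : ℝ) = (s.eval w 0 - s0.eval w 0) + (row 0 w - row 0 mid₀) +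
      (row 0 mid₀ - (0.061 : ℝ)) := by
    rw [s0_eval]
    ring
  rw [h3]
  refine (norm_add_le_of_le (norm_add_le_of_le hp h1) h2).trans ?_
  norm_num

end Numerics

/-! ### Construction and uniqueness of `λ` and `z`, and properties of `ℛ`. -/

section Solution

open Metric Filter Topology

/-- Existence comes from the small disc about `lam₀`; uniqueness extends to the unit disc because
two roots there would violate `scaling_lipschitz`. -/
theorem exists_scaling : ∃ L : A rho → ℂ, AnalyticOnNhd ℂ L (ball s0 delta) ∧
    ∀ s ∈ ball s0 delta, L s ∈ ball (lam₀ : ℂ) 0.012 ∧ s.eval (L s) 1 + s.eval 0 1 = 0 ∧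
      ∀ l, ‖l‖ ≤ 1 → s.eval l 1 + s.eval 0 1 = 0 → l = L s := by
  have h1 : (1 : ℝ) < rho := by norm_num [rho]
  have hD : (-0.974 : ℂ) ≠ 0 := by norm_num
  have hF : ∀ s ∈ ball s0 delta, ∀ l ∈ closedBall (lam₀ : ℂ) 0.012,
      AnalyticAt ℂ (fun v : A rho × ℂ => v.1.eval v.2 1 + v.1.eval 0 1) (s, l) := by
    intro s _ l hl
    have hl1 := (norm_le_of_mem_closedBall_lam hl).trans_lt (show (0.261 : ℝ) < rho by
      norm_num [rho])
    have h2 : AnalyticAt ℂ (fun v : A rho × ℂ => (v.1, v.2, (1 : ℂ))) (s, l) :=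
      analyticAt_fst.prod (analyticAt_snd.prod analyticAt_const)
    have h3 : AnalyticAt ℂ (fun v : A rho × ℂ => (v.1, (0 : ℂ), (1 : ℂ))) (s, l) :=
      analyticAt_fst.prod (analyticAt_const.prod analyticAt_const)
    exact ((A.analyticAt_eval hl1 (y := 1) (by simpa using h1)).comp_of_eq h2 rfl).add
      ((A.analyticAt_eval (x := 0) (y := 1) (by simpa using zero_lt_one.trans h1)
        (by simpa using h1)).comp_of_eq h3 rfl)
  obtain ⟨L, hL, hL'⟩ := exists_analytic_root (R := 0.012) (κ := 0.062) isOpen_ball (by norm_num)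
    (by norm_num) hD (by norm_num) hF
    (fun s hs l hl l' hl' => scaling_lipschitz hs
      ((norm_le_of_mem_closedBall_lam hl).trans (by norm_num))
      ((norm_le_of_mem_closedBall_lam hl').trans (by norm_num)))
    (fun s hs l hl => scaling_close hs hl)
  refine ⟨L, hL, fun s hs => ?_⟩
  obtain ⟨h2, h3, -⟩ := hL' s hs
  refine ⟨h2, h3, fun l hl hl0 => ?_⟩
  have h4 := scaling_lipschitz hs hl ((norm_le_of_mem_closedBall_lam
    (ball_subset_closedBall h2)).trans (by norm_num))
  rw [hl0, h3, sub_zero, zero_sub, norm_neg, norm_mul] at h4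
  have h5 : ‖l - L s‖ = 0 := by nlinarith [norm_nonneg (l - L s), norm_pos_iff.2 hD]
  exact sub_eq_zero.1 (norm_eq_zero.1 h5)

/-- The solution of `s(l, 1) + s(0, 1) = 0` in the unit disc. -/
noncomputable def scaling : A rho → ℂ := exists_scaling.choose

theorem analyticOnNhd_scaling : AnalyticOnNhd ℂ scaling (ball s0 delta) :=
  exists_scaling.choose_spec.1

variable {s : A rho}

theorem scaling_mem (hs : s ∈ ball s0 delta) : scaling s ∈ ball (lam₀ : ℂ) 0.012 :=
  (exists_scaling.choose_spec.2 s hs).1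

theorem scaling_eq (hs : s ∈ ball s0 delta) : s.eval (scaling s) 1 + s.eval 0 1 = 0 :=
  (exists_scaling.choose_spec.2 s hs).2.1

theorem eq_scaling (hs : s ∈ ball s0 delta) {l : ℂ} (hl : ‖l‖ ≤ 1)
    (h : s.eval l 1 + s.eval 0 1 = 0) : l = scaling s :=
  (exists_scaling.choose_spec.2 s hs).2.2 l hl h

theorem norm_scaling_mul_le (hs : s ∈ ball s0 delta) {x : ℂ} (hx : ‖x‖ ≤ 1.89) :
    ‖scaling s * x‖ ≤ 1 / 2 :=
  (norm_mul_le_of_le (norm_le_of_mem_closedBall_lam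
    (ball_subset_closedBall (scaling_mem hs))) hx).trans (by norm_num)

theorem norm_lt_rho_of_le_half {x : ℂ} (hx : ‖x‖ ≤ 1 / 2) : ‖x‖ < rho :=
  hx.trans_lt (by norm_num [rho])

theorem norm_lt_rho_of_mem_closedBall_mid {w : ℂ} (hw : w ∈ closedBall (mid₀ : ℂ) 0.4) :
    ‖w‖ < rho :=
  (norm_le_of_mem_closedBall_mid hw).trans_lt (by norm_num [rho])

/-- The domain of the midpoint function, jointly in `s` and the point. -/
def domain : Set (A rho × ℂ × ℂ) := ball s0 delta ×ˢ ball 0 1.89 ×ˢ ball 0 1.89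

theorem isOpen_domain : IsOpen domain := isOpen_ball.prod (isOpen_ball.prod isOpen_ball)

theorem analyticAt_scaling_fst {v : A rho × ℂ × ℂ} (hv : v ∈ domain) :
    AnalyticAt ℂ (fun v : A rho × ℂ × ℂ => scaling v.1) v :=
  (analyticOnNhd_scaling v.1 hv.1).comp_of_eq analyticAt_fst rfl

/-- The estimates for the two summands add up: the slope doubles, while the contraction factor and
the radius stay the same. -/
theorem exists_midpoint : ∃ z : A rho × ℂ × ℂ → ℂ, AnalyticOnNhd ℂ z domain ∧
    ∀ v ∈ domain, z v ∈ ball (mid₀ : ℂ) 0.4 ∧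
      v.1.eval (scaling v.1 * v.2.1) (z v) + v.1.eval (scaling v.1 * v.2.2) (z v) = 0 ∧
      ∀ w ∈ closedBall (mid₀ : ℂ) 0.4,
        v.1.eval (scaling v.1 * v.2.1) w + v.1.eval (scaling v.1 * v.2.2) w = 0 → w = z v := by
  have hD : ‖(2 * -1.888 : ℂ)‖ = 2 * ‖(-1.888 : ℂ)‖ := by rw [norm_mul, Complex.norm_two]
  have hx : ∀ v ∈ domain, ‖scaling v.1 * v.2.1‖ ≤ 1 / 2 := fun v hv =>
    norm_scaling_mul_le hv.1 (mem_ball_zero_iff.1 hv.2.1).le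
  have hy : ∀ v ∈ domain, ‖scaling v.1 * v.2.2‖ ≤ 1 / 2 := fun v hv =>
    norm_scaling_mul_le hv.1 (mem_ball_zero_iff.1 hv.2.2).le
  refine exists_analytic_root (P := A rho × ℂ × ℂ) isOpen_domain
    (F := fun v => v.1.1.eval (scaling v.1.1 * v.1.2.1) v.2 +
      v.1.1.eval (scaling v.1.1 * v.1.2.2) v.2) (w₀ := (mid₀ : ℂ))
    (D := 2 * -1.888) (R := 0.4) (κ := 0.41) (by norm_num) (by norm_num) (by norm_num)
    (by norm_num) ?_ ?_ ?_
  · intro v hv w hw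
    have h1 : AnalyticAt ℂ (fun u : (A rho × ℂ × ℂ) × ℂ => scaling u.1.1) (v, w) :=
      (analyticAt_scaling_fst hv).comp_of_eq analyticAt_fst rfl
    have h0 : AnalyticAt ℂ (fun u : (A rho × ℂ × ℂ) × ℂ => u.1.1) (v, w) :=
      analyticAt_fst.comp analyticAt_fst
    have h2 : AnalyticAt ℂ (fun u : (A rho × ℂ × ℂ) × ℂ => u.1.2.1) (v, w) :=
      analyticAt_fst.comp (analyticAt_snd.comp analyticAt_fst)
    have h3 : AnalyticAt ℂ (fun u : (A rho × ℂ × ℂ) × ℂ => u.1.2.2) (v, w) :=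
      analyticAt_snd.comp (analyticAt_snd.comp analyticAt_fst)
    have hwr := norm_lt_rho_of_mem_closedBall_mid hw
    exact ((A.analyticAt_eval (norm_lt_rho_of_le_half (hx v hv)) hwr).comp_of_eq
        (h0.prod ((h1.mul h2).prod analyticAt_snd)) rfl).add
      ((A.analyticAt_eval (norm_lt_rho_of_le_half (hy v hv)) hwr).comp_of_eq
        (h0.prod ((h1.mul h3).prod analyticAt_snd)) rfl)
  · intro v hv w hw w' hw'
    have h := norm_add_le_of_le (midpoint_lipschitz hv.1 (hx v hv) hw hw')
      (midpoint_lipschitz hv.1 (hy v hv) hw hw')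
    rw [hD]
    refine (le_of_eq ?_).trans (h.trans (le_of_eq (by ring)))
    congr 1
    ring
  · intro v hv w hw
    have h := (norm_add_le _ _).trans_lt (add_lt_add (midpoint_close hv.1 (hx v hv) hw)
      (midpoint_close hv.1 (hy v hv) hw))
    rw [hD]
    refine (le_of_eq ?_).trans_lt (h.trans_eq (by ring))
    congr 1
    ring

/-- The midpoint function, jointly in `s` and the point. -/
noncomputable def midpoint : A rho × ℂ × ℂ → ℂ := exists_midpoint.choose

theorem analyticOnNhd_midpoint : AnalyticOnNhd ℂ midpoint domain :=
  exists_midpoint.choose_spec.1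

theorem midpoint_mem {v : A rho × ℂ × ℂ} (hv : v ∈ domain) :
    midpoint v ∈ ball (mid₀ : ℂ) 0.4 :=
  (exists_midpoint.choose_spec.2 v hv).1

theorem midpoint_eq {v : A rho × ℂ × ℂ} (hv : v ∈ domain) :
    v.1.eval (scaling v.1 * v.2.1) (midpoint v) +
      v.1.eval (scaling v.1 * v.2.2) (midpoint v) = 0 :=
  (exists_midpoint.choose_spec.2 v hv).2.1

theorem eq_midpoint {v : A rho × ℂ × ℂ} (hv : v ∈ domain) {w : ℂ}
    (hw : w ∈ closedBall (mid₀ : ℂ) 0.4)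
    (h : v.1.eval (scaling v.1 * v.2.1) w + v.1.eval (scaling v.1 * v.2.2) w = 0) :
    w = midpoint v :=
  (exists_midpoint.choose_spec.2 v hv).2.2 w hw h

theorem norm_midpoint_lt {v : A rho × ℂ × ℂ} (hv : v ∈ domain) : ‖midpoint v‖ < rho :=
  norm_lt_rho_of_mem_closedBall_mid (ball_subset_closedBall (midpoint_mem hv))

theorem mem_domain (hs : s ∈ ball s0 delta) {p : ℂ × ℂ} (hp : p ∈ bidisk rho) :
    (s, p) ∈ domain := by
  have h : rho < 1.89 := by norm_num [rho]
  exact ⟨hs, mem_ball_zero_iff.2 (hp.1.trans h), mem_ball_zero_iff.2 (hp.2.trans h)⟩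

theorem one_mem_ball_mid : (1 : ℂ) ∈ ball (mid₀ : ℂ) 0.4 := by
  have h : (1 : ℂ) - mid₀ = ((1 - mid₀ : ℝ) : ℂ) := by push_cast; rfl
  rw [mem_ball_iff_norm, h, Complex.norm_real]
  norm_num [mid₀, abs_of_pos]

theorem one_zero_mem_bidisk : ((1 : ℂ), (0 : ℂ)) ∈ bidisk rho := by
  constructor <;> norm_num [rho]

theorem zero_one_mem_bidisk : ((0 : ℂ), (1 : ℂ)) ∈ bidisk rho := by
  constructor <;> norm_num [rho]

theorem zero_mem_bidisk : ((0 : ℂ), (0 : ℂ)) ∈ bidisk rho := by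
  constructor <;> norm_num [rho]

theorem isMidpoint_midpoint (hs : s ∈ ball s0 delta) :
    IsMidpoint s (scaling s) fun p => midpoint (s, p) where
  scaling_eq := scaling_eq hs
  analytic p hp := (analyticOnNhd_midpoint (s, p) (mem_domain hs hp)).comp_of_eq
    (analyticAt_const.prod analyticAt_id) rfl
  arg_mem p hp := by
    have h := mem_domain hs hp
    exact ⟨norm_lt_rho_of_le_half (norm_scaling_mul_le hs (mem_ball_zero_iff.1 h.2.1).le),
      norm_lt_rho_of_le_half (norm_scaling_mul_le hs (mem_ball_zero_iff.1 h.2.2).le),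
      norm_midpoint_lt h⟩
  midpoint_eq p hp := midpoint_eq (mem_domain hs hp)
  normalized := by
    have h1 := ball_subset_closedBall one_mem_ball_mid
    refine ⟨(eq_midpoint (mem_domain hs one_zero_mem_bidisk) h1 ?_).symm,
      (eq_midpoint (mem_domain hs zero_one_mem_bidisk) h1 ?_).symm⟩
    · simpa using scaling_eq hs
    · simpa [add_comm] using scaling_eq hs

theorem convex_bidisk (r : ℝ) : Convex ℝ (bidisk r) := by
  have h : bidisk r = ball 0 r ×ˢ ball 0 r := by
    ext p
    simp [bidisk]
  rw [h]
  exact (convex_ball 0 r).prod (convex_ball 0 r)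

theorem isOpen_bidisk (r : ℝ) : IsOpen (bidisk r) :=
  (isOpen_lt (by fun_prop : Continuous fun p : ℂ × ℂ => ‖p.1‖) continuous_const).inter
    (isOpen_lt (by fun_prop : Continuous fun p : ℂ × ℂ => ‖p.2‖) continuous_const)

/-- If `|l| > 1`, the point `(ρ / |l|, 0)` of the bidisk would be scaled to modulus exactly `ρ`. -/
theorem IsMidpoint.norm_le_one {l : ℂ} {z : ℂ × ℂ → ℂ} (h : IsMidpoint s l z) : ‖l‖ ≤ 1 := by
  by_contra! hl
  have h0 : (0 : ℝ) < rho := by norm_num [rho]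
  have hl0 : 0 < ‖l‖ := zero_lt_one.trans hl
  have hx : ‖((rho / ‖l‖ : ℝ) : ℂ)‖ = rho / ‖l‖ := by
    rw [Complex.norm_real, Real.norm_eq_abs, abs_of_pos (by positivity)]
  have h1 := (h.arg_mem ((rho / ‖l‖ : ℝ), 0) ⟨by
    rw [hx]
    exact div_lt_self h0 hl, by simpa using h0⟩).1
  rw [norm_mul, hx, mul_div_cancel₀ _ hl0.ne'] at h1
  exact lt_irrefl _ h1

theorem IsMidpoint.eq_scaling {l : ℂ} {z : ℂ × ℂ → ℂ} (h : IsMidpoint s l z)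
    (hs : s ∈ ball s0 delta) : l = scaling s :=
  EKW.eq_scaling hs h.norm_le_one h.scaling_eq

theorem IsMidpoint.eqOn_midpoint {l : ℂ} {z : ℂ × ℂ → ℂ} (h : IsMidpoint s l z)
    (hs : s ∈ ball s0 delta) : Set.EqOn z (fun p => midpoint (s, p)) (bidisk rho) := by
  refine h.analytic.eqOn_of_preconnected_of_eventuallyEq (isMidpoint_midpoint hs).analytic
    (convex_bidisk rho).isPreconnected one_zero_mem_bidisk ?_
  -- Nothing confines `z` to the disc about `mid₀` in general; only the normalization does so, near
  -- `(1, 0)`, and that suffices for the identity theorem.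
  have h1 : ∀ᶠ p in 𝓝 ((1 : ℂ), (0 : ℂ)), z p ∈ ball (mid₀ : ℂ) 0.4 :=
    (h.analytic _ one_zero_mem_bidisk).continuousAt.eventually_mem (isOpen_ball.mem_nhds (by
      rw [h.normalized.1]
      exact one_mem_ball_mid))
  filter_upwards [h1, (isOpen_bidisk rho).mem_nhds one_zero_mem_bidisk] with p hp hpb
  refine eq_midpoint (mem_domain hs hpb) (ball_subset_closedBall hp) ?_
  rw [← h.eq_scaling hs]
  exact h.midpoint_eq p hpb

theorem isMidpoint_lam_mid (hs : s ∈ ball s0 delta) : IsMidpoint s (lam s) (mid s) := by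
  have h : ∃ d : ℂ × (ℂ × ℂ → ℂ), IsMidpoint s d.1 d.2 := ⟨(_, _), isMidpoint_midpoint hs⟩
  have h1 : solution s = h.choose := dif_pos h
  rw [lam, mid, h1]
  exact h.choose_spec

theorem lam_eq (hs : s ∈ ball s0 delta) : lam s = scaling s :=
  (isMidpoint_lam_mid hs).eq_scaling hs

theorem mid_eq (hs : s ∈ ball s0 delta) {p : ℂ × ℂ} (hp : p ∈ bidisk rho) :
    mid s p = midpoint (s, p) :=
  (isMidpoint_lam_mid hs).eqOn_midpoint hs hp

theorem mu_eq (hs : s ∈ ball s0 delta) : mu s = s.eval (midpoint (s, 0, 0)) 0 := by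
  rw [mu, mid_eq hs zero_mem_bidisk]

theorem norm_mu_sub_le (hs : s ∈ ball s0 delta) : ‖mu s - (0.061 : ℝ)‖ ≤ 0.02 := by
  have hd := mem_domain hs zero_mem_bidisk
  rw [mu_eq hs]
  refine norm_eval_mid_sub_le hs (norm_sub_mid_le hs (ball_subset_closedBall (midpoint_mem hd)) ?_)
  -- At the origin both summands equal `s(0, z(0, 0))`, so this value vanishes.
  have h := midpoint_eq hd
  simp only [mul_zero] at h
  exact add_self_eq_zero.1 h

theorem norm_mu_ge (hs : s ∈ ball s0 delta) : 0.04 ≤ ‖mu s‖ := by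
  have h1 := norm_mu_sub_le hs
  have h2 := norm_sub_norm_le ((0.061 : ℝ) : ℂ) (mu s)
  rw [norm_sub_rev, Complex.norm_real, Real.norm_eq_abs, abs_of_pos (by norm_num)] at h2
  linarith

theorem mu_ne_zero (hs : s ∈ ball s0 delta) : mu s ≠ 0 :=
  norm_pos_iff.1 ((by norm_num : (0 : ℝ) < 0.04).trans_le (norm_mu_ge hs))

theorem analyticOnNhd_mu : AnalyticOnNhd ℂ (mu : A rho → ℂ) (ball s0 delta) := by
  intro s hs
  have hd := mem_domain hs zero_mem_bidisk
  have h0 : ‖(0 : ℂ)‖ < rho := by norm_num [rho]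
  have h1 : AnalyticAt ℂ (fun s : A rho => midpoint (s, 0, 0)) s :=
    (analyticOnNhd_midpoint _ hd).comp_of_eq
      (analyticAt_id.prod (analyticAt_const.prod analyticAt_const)) rfl
  have h2 : AnalyticAt ℂ (fun s : A rho => s.eval (midpoint (s, 0, 0)) 0) s :=
    (A.analyticAt_eval (norm_midpoint_lt hd) h0).comp_of_eq
      (analyticAt_id.prod (h1.prod analyticAt_const)) rfl
  refine h2.congr ?_
  filter_upwards [isOpen_ball.mem_nhds hs] with t ht
  exact (mu_eq ht).symm

/-- The values of the renormalized functions. -/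
noncomputable def renormValue (v : A rho × ℂ × ℂ) : ℂ :=
  (mu v.1)⁻¹ * v.1.eval (midpoint v) (scaling v.1 * v.2.2)

theorem analyticOnNhd_renormValue : AnalyticOnNhd ℂ renormValue domain := by
  intro v hv
  have h1 : AnalyticAt ℂ (fun v : A rho × ℂ × ℂ => mu v.1) v :=
    (analyticOnNhd_mu v.1 hv.1).comp_of_eq analyticAt_fst rfl
  have h2 : AnalyticAt ℂ (fun v : A rho × ℂ × ℂ => v.2.2) v :=
    analyticAt_snd.comp analyticAt_snd
  exact (h1.inv (mu_ne_zero hv.1)).mul ((A.analyticAt_eval (norm_midpoint_lt hv)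
    (norm_lt_rho_of_le_half (norm_scaling_mul_le hv.1 (mem_ball_zero_iff.1 hv.2.2).le))).comp_of_eq
    (analyticAt_fst.prod ((analyticOnNhd_midpoint v hv).prod
      ((analyticAt_scaling_fst hv).mul h2))) rfl)

theorem norm_renormValue_le {v : A rho × ℂ × ℂ} (hv : v ∈ domain) :
    ‖renormValue v‖ ≤ 25 * (delta + ‖s0‖) := by
  rw [renormValue]
  refine norm_mul_le_of_le ?_ (((v.1.norm_eval_le (norm_midpoint_lt hv).le
    (norm_lt_rho_of_le_half (norm_scaling_mul_le hv.1 (mem_ball_zero_iff.1 hv.2.2).le)).le)).trans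
    ?_)
  · rw [norm_inv]
    exact (inv_anti₀ (by norm_num) (norm_mu_ge hv.1)).trans (by norm_num)
  · have h := norm_add_le_of_le (mem_ball_iff_norm.1 hv.1).le (le_refl ‖s0‖)
    rwa [sub_add_cancel] at h

/-- The radius `1.88` lies between `ρ'` and the radius `1.89` of `domain`; the bound is uniform in
`s`, with `25 = 1 / 0.04` from the lower bound on `|μ|`. -/
theorem exists_renormCoeff : ∃ c : ℕ × ℕ → A rho → ℂ,
    (∀ n, AnalyticOnNhd ℂ (c n) (ball s0 delta)) ∧
    (∀ n, ∀ s ∈ ball s0 delta, ‖c n s‖ ≤ 25 * (delta + ‖s0‖) / 1.88 ^ (n.1 + n.2)) ∧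
    ∀ s ∈ ball s0 delta, ∀ p ∈ bidisk rho,
      HasSum (fun n => c n s * p.1 ^ n.1 * p.2 ^ n.2) (renormValue (s, p)) := by
  obtain ⟨c, h1, h2, h3⟩ := exists_analytic_coeff isOpen_ball (r' := 1.88) (by norm_num)
    (by norm_num) analyticOnNhd_renormValue fun v hv => norm_renormValue_le hv
  have h : rho < 1.88 := by norm_num [rho]
  exact ⟨c, h1, h2, fun s hs p hp => h3 s hs p.1 (mem_ball_zero_iff.2 (hp.1.trans h)) p.2
    (mem_ball_zero_iff.2 (hp.2.trans h))⟩

/-- The Taylor coefficients of the renormalized functions. -/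
noncomputable def renormCoeff : ℕ × ℕ → A rho → ℂ := exists_renormCoeff.choose

theorem analyticOnNhd_renormCoeff (n : ℕ × ℕ) :
    AnalyticOnNhd ℂ (renormCoeff n) (ball s0 delta) :=
  exists_renormCoeff.choose_spec.1 n

theorem norm_renormCoeff_le (hs : s ∈ ball s0 delta) (n : ℕ × ℕ) :
    ‖renormCoeff n s‖ ≤ 25 * (delta + ‖s0‖) / 1.88 ^ (n.1 + n.2) :=
  exists_renormCoeff.choose_spec.2.1 n s hs

theorem hasSum_renormCoeff (hs : s ∈ ball s0 delta) {p : ℂ × ℂ} (hp : p ∈ bidisk rho) :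
    HasSum (fun n => renormCoeff n s * p.1 ^ n.1 * p.2 ^ n.2) (renormValue (s, p)) :=
  exists_renormCoeff.choose_spec.2.2 s hs p hp

theorem rho_lt : rho < 1.88 := by norm_num [rho]

theorem rho'_lt : rho' < 1.88 := by norm_num [rho', rho]

theorem eval_ofCoeff_renormCoeff (hs : s ∈ ball s0 delta) {p : ℂ × ℂ} (hp : p ∈ bidisk rho) :
    (A.ofCoeff rho fun n => renormCoeff n s).eval p.1 p.2 =
      (mu s)⁻¹ * s.eval (mid s p) (lam s * p.2) := by
  rw [A.eval, mid_eq hs hp, lam_eq hs]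
  refine Eq.trans (tsum_congr fun n => ?_) (hasSum_renormCoeff hs hp).tsum_eq
  rw [A.coeff_ofCoeff rho_lt (norm_renormCoeff_le hs)]

theorem renorm_eval (hs : s ∈ ball s0 delta) {p : ℂ × ℂ} (hp : p ∈ bidisk rho) :
    (renorm s).eval p.1 p.2 = (mu s)⁻¹ * s.eval (mid s p) (lam s * p.2) := by
  have h : ∃ t : A rho, ∀ p ∈ bidisk rho,
      t.eval p.1 p.2 = (mu s)⁻¹ * s.eval (mid s p) (lam s * p.2) :=
    ⟨_, fun p hp => eval_ofCoeff_renormCoeff hs hp⟩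
  rw [renorm, dif_pos h]
  exact h.choose_spec p hp

theorem renorm_eq_ofCoeff (hs : s ∈ ball s0 delta) :
    renorm s = A.ofCoeff rho fun n => renormCoeff n s :=
  A.eq_of_eval_eq fun p hp => by rw [renorm_eval hs hp, eval_ofCoeff_renormCoeff hs hp]

theorem wellDefinedAt (hs : s ∈ ball s0 delta) : WellDefinedAt s where
  isMidpoint := isMidpoint_lam_mid hs
  unique l z h := ⟨by rw [lam_eq hs, h.eq_scaling hs], fun p hp => by
    rw [mid_eq hs hp, h.eqOn_midpoint hs hp]⟩
  mu_ne_zero := mu_ne_zero hs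
  renorm_eq p hp := renorm_eval hs hp

theorem analyticOnNhd_renorm : AnalyticOnNhd ℂ (renorm : A rho → A rho) (ball s0 delta) :=
  (analyticOnNhd_ofCoeff isOpen_ball rho_lt analyticOnNhd_renormCoeff
    fun n _ hs => norm_renormCoeff_le hs n).congr isOpen_ball fun _ hs =>
    (renorm_eq_ofCoeff hs).symm

theorem isCompactMapOn_renorm : IsCompactMapOn (renorm : A rho → A rho) (ball s0 delta) := by
  refine ⟨analyticOnNhd_renorm.continuousOn, fun B hB _ => ?_⟩
  refine (A.isCompact_ofCoeff_image (ρ := rho) (M := 25 * (delta + ‖s0‖)) rho_lt).closure_of_subset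
    ?_
  rintro _ ⟨s, hs, rfl⟩
  exact ⟨fun n => renormCoeff n s, norm_renormCoeff_le (hB hs), (renorm_eq_ofCoeff (hB hs)).symm⟩

/-- The same coefficients define an element of the smaller space `𝒜(ρ')`, since `ρ' < 1.88`; the
normalization is read off from the coefficient at the origin. -/
theorem exists_mem_I_coeff_eq (hs : s ∈ ball s0 delta) :
    ∃ t ∈ I rho', t.coeff = (renorm s).coeff := by
  have h : (A.ofCoeff rho' fun n => renormCoeff n s).coeff = (renorm s).coeff := by
    funext i j
    rw [renorm_eq_ofCoeff hs, A.coeff_ofCoeff rho_lt (norm_renormCoeff_le hs),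
      A.coeff_ofCoeff rho'_lt (norm_renormCoeff_le hs)]
  refine ⟨_, ?_, h⟩
  change A.eval _ 0 0 = 1
  have h1 := renorm_eval hs zero_mem_bidisk
  rw [A.eval_zero_zero, h, ← A.eval_zero_zero]
  refine h1.trans ?_
  rw [mul_zero]
  exact inv_mul_cancel₀ (mu_ne_zero hs)

end Solution

/-! ### Reality of `λ` and `μ` by conjugation symmetry. -/

section Real

open Metric ComplexConjugate

variable {ρ : ℝ} [hρ : Fact (0 < ρ)]

theorem A.conj_eval {s : A ρ} (hs : ∀ i j, (s.coeff i j).im = 0) (x y : ℂ) :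
    conj (s.eval x y) = s.eval (conj x) (conj y) := by
  rw [A.eval, Complex.conj_tsum]
  refine tsum_congr fun p => ?_
  rw [map_mul, map_mul, map_pow, map_pow, Complex.conj_eq_iff_im.2 (hs _ _)]

theorem conj_mem_closedBall {a : ℝ} {r : ℝ} {w : ℂ} (hw : w ∈ closedBall (a : ℂ) r) :
    conj w ∈ closedBall (a : ℂ) r := by
  rw [mem_closedBall_iff_norm] at hw ⊢
  rwa [← Complex.conj_ofReal, ← map_sub, Complex.norm_conj]

theorem abs_sub_le_of_mem_closedBall {a b r : ℝ} (h : (b : ℂ) ∈ closedBall (a : ℂ) r) :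
    |b - a| ≤ r := by
  rwa [mem_closedBall_iff_norm, ← Complex.ofReal_sub, Complex.norm_real] at h

variable {s : A rho}

theorem conj_scaling (hs : s ∈ ball s0 delta) (hr : ∀ i j, (s.coeff i j).im = 0) :
    conj (scaling s) = scaling s := by
  refine eq_scaling hs ?_ ?_
  · rw [Complex.norm_conj]
    exact (norm_le_of_mem_closedBall_lam (ball_subset_closedBall (scaling_mem hs))).trans
      (by norm_num)
  · have h := congrArg conj (scaling_eq hs)
    simpa [A.conj_eval hr] using h

theorem conj_mu (hs : s ∈ ball s0 delta) (hr : ∀ i j, (s.coeff i j).im = 0) :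
    conj (mu s) = mu s := by
  have hd := mem_domain hs zero_mem_bidisk
  have h1 : conj (midpoint (s, 0, 0)) = midpoint (s, 0, 0) := by
    -- The disc has a real centre, so the conjugate root lies in it and uniqueness applies.
    refine eq_midpoint hd (conj_mem_closedBall (ball_subset_closedBall (midpoint_mem hd))) ?_
    have h := congrArg conj (midpoint_eq hd)
    simpa [A.conj_eval hr] using h
  rw [mu_eq hs, A.conj_eval hr, h1, map_zero]

end Real
end EKW

theorem mainTheorem1 :
    EKW.s0Poly.totalDegree = 9 ∧ EKW.s0 ∈ EKW.I EKW.rho ∧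
    -- the operator is well defined and analytic on the ball
    ((∀ s ∈ Metric.ball EKW.s0 EKW.delta, EKW.WellDefinedAt s) ∧
      AnalyticOnNhd ℂ (EKW.renorm : EKW.A EKW.rho → EKW.A EKW.rho)
        (Metric.ball EKW.s0 EKW.delta)) ∧
    -- bounds on the scalings for real Taylor coefficients
    (∀ s ∈ Metric.ball EKW.s0 EKW.delta, (∀ i j, (s.coeff i j).im = 0) →
      ∃ l m : ℝ, EKW.lam s = (l : ℂ) ∧ EKW.mu s = (m : ℂ) ∧
        0.000406771898269653 ≤ m ∧ m ≤ 0.120654106140137 ∧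
        -0.276069164276123 ≤ l ∧ l ≤ -0.222213745117188) ∧
    -- compactness, with values in the normalized functions of the larger bidisk
    (EKW.IsCompactMapOn (EKW.renorm : EKW.A EKW.rho → EKW.A EKW.rho)
        (Metric.ball EKW.s0 EKW.delta) ∧
      ∀ s ∈ Metric.ball EKW.s0 EKW.delta,
        ∃ t ∈ EKW.I EKW.rho', t.coeff = (EKW.renorm s).coeff) := by
  refine ⟨EKW.s0Poly_totalDegree, EKW.s0_mem_I, ⟨fun s hs => EKW.wellDefinedAt hs,
    EKW.analyticOnNhd_renorm⟩, fun s hs hr => ?_, EKW.isCompactMapOn_renorm,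
    fun s hs => EKW.exists_mem_I_coeff_eq hs⟩
  obtain ⟨l, hl⟩ := Complex.conj_eq_iff_real.1 (EKW.conj_scaling hs hr)
  obtain ⟨m, hm⟩ := Complex.conj_eq_iff_real.1 (EKW.conj_mu hs hr)
  have h1 := Metric.ball_subset_closedBall (EKW.scaling_mem hs)
  have h2 := mem_closedBall_iff_norm.2 (EKW.norm_mu_sub_le hs)
  rw [hl] at h1
  rw [hm] at h2
  have h3 := abs_le.1 (EKW.abs_sub_le_of_mem_closedBall h1)
  have h4 := abs_le.1 (EKW.abs_sub_le_of_mem_closedBall h2)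
  rw [EKW.lam₀] at h3
  -- The intervals `-0.249 ± 0.012` and `0.061 ± 0.02` lie inside the required ones.
  refine ⟨l, m, (EKW.lam_eq hs).trans hl, hm, ?_, ?_, ?_, ?_⟩ <;> linarith [h3.1, h3.2, h4.1, h4.2]
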